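/- Let $k$ be an algebraically closed field of characteristic $0$, let $\bar X$ be a smooth, proper, connected (integral) curve over $k$, let $X\subset\bar X$ be a nonempty affine open subscheme, $D=\bar X\setminus X$ (a reduced divisor), and let $N\ge 0$ be an integer. Let $\mathfrak{Aff}$ be the category of affine $k$-schemes of finite type with the Zariski topology; "presheaf" means presheaf of sets on $\mathfrak{Aff}$. *Notation.* For $S\in\mathfrak{Aff}$, a *domain* in $S\times X$ is an open subset $U\subset S\times X$ that surjects onto $S$. A *line sub-bundle* of a vector bundle is a sub-line-bundle whose quotient is again a vector bundle. The presheaf $\mathcal L$ of *generic lines* in the trivial bundle of rank $N$ is $$\mathcal L(S)=\operatorname{colim}_U\{\text{line sub-bundles of }\mathcal O_U^{N}\},$$ the colimit being over all domains $U$ in $S\times X$ and restriction maps. For $d\ge 0$ let $k^d[X]=\Gamma(\bar X,\mathcal O_{\bar X}(dD))$, and let $\mathcal M_d$ and $\mathcal L_d$ be the functors of points of the projective spaces of lines $\mathbb P(k^d[X])$ and $\mathbb P(k^d[X]^{N})$: an $S$-point is a line sub-bundle of the trivial bundle on $S$ with the given fibre. Put $\mathcal M_\infty=\operatorname{colim}_d\mathcal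 M_d$ and $\mathcal L_\infty=\operatorname{colim}_d\mathcal L_d$ (colimits of presheaves). Multiplication of functions $k^d[X]\times k^e[X]\to k^{d+e}[X]$, $k^d[X]\times k^e[X]^{N}\to k^{d+e}[X]^{N}$ makes $\mathcal M_\infty$ a presheaf of commutative monoids that acts on $\mathcal L_\infty$: the product of two line sub-bundles is the line sub-bundle generated by the products of their sections. Let $F_d:\mathcal L_d\to\mathcal L$ be the map that sends a line sub-bundle $W\subset\mathcal O_S\otimes k^d[X]^{N}$ to the image of the pull back of $W$ to $S\times X$ in $\mathcal O^{N}$, over the domain where this image is a line sub-bundle, i.e. where the sections of $W$ do not all vanish. These maps are compatible and define $F_\infty:\mathcal L_\infty\to\mathcal L$. For a sub-presheaf $\mathcal B\subset\mathcal L$ and $0\le d\le\infty$ let $\mathcal B_d=\mathcal B\times_{\mathcal L}\mathcal L_d$ be the pullback of $\mathcal B$ along $F_d$, and let $F_d^{\mathcal B}:\mathcal B_d\to\mathcal B$ be the projection. **Proposition.** For every sub-presheaf $\mathcal B\subset\mathcal L$: 1. for every $d\ge 0$, $\mathcal B_d\to\mathcal L_d$ is a sub-presheaf; 2. $\mathcal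 B_\infty=\operatorname{colim}_d\mathcal B_d$ via the natural maps $\mathcal B_d\to\mathcal B_\infty$; 3. $F^{\mathcal B}_\infty:\mathcal B_\infty\to\mathcal B$ is a Zariski-local epimorphism: every section of $\mathcal B$ lifts to $\mathcal B_\infty$ Zariski-locally on $S$; 4. the action of $\mathcal M_\infty$ on $\mathcal L_\infty$ restricts to an action on $\mathcal B_\infty$; 5. this action preserves the fibres of $F^{\mathcal B}_\infty$: $F_\infty(m f)=F_\infty(f)$ for all $S$, $m\in\mathcal M_\infty(S)$, $f\in\mathcal B_\infty(S)$; 6. for every $S$ the action of $\mathcal M_\infty(S)$ on $\mathcal B_\infty(S)$ is free: $mf=nf$ implies $m=n$; 7. if $f,g\in\mathcal B_\infty(S)$ and $F_\infty(f)=F_\infty(g)$, then every point of $S$ has an affine open neighbourhood $O\subset S$ with $m_1,m_2\in\mathcal M_\infty(O)$ such that $m_1\cdot f|_O=m_2\cdot g|_O$; 8. let $\mathcal B_\infty/\mathcal M_\infty$ be the presheaf quotient of $\mathcal B_\infty$ by the equivalence relation generated by $f\sim mf$. The map $F^{\mathcal B}_\infty$ factors through a map $\mathcal B_\infty/\mathcal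 M_\infty\to\mathcal B$, which becomes an isomorphism after Zariski sheafification. -/

import Mathlib

open CategoryTheory Opposite TensorProduct AlgebraicGeometry Limits TopologicalSpace

universe u

noncomputable section

namespace GenericLines

section LineSubbundle

/-- A submodule `W` of an `R`-module `M` is a line sub-bundle (a sub-bundle of rank one) of the
bundle on `Spec R` given by `M`: `W` is a line bundle and `M / W` is again a bundle. -/
structure IsLineSubbundle {R M : Type*} [CommRing R] [AddCommGroup M] [Module R M]
    (W : Submodule R M) : Prop where
  invertible : Module.Invertible R W
  projective_quotient : Module.Projective R (M ⧸ W)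

/-- The ideal generated by the values of all linear forms on a set of vectors is the unit ideal. -/
def IsUnimodular {M : Type*} (R : Type*) [CommRing R] [AddCommGroup M] [Module R M]
    (s : Set M) : Prop :=
  Ideal.span {r : R | ∃ f : M →ₗ[R] R, ∃ w ∈ s, f w = r} = ⊤

variable {R : Type*} [CommRing R] {M : Type*} [AddCommGroup M] [Module R M]

lemma IsUnimodular.mono {s t : Set M} (h : s ⊆ t) (hs : IsUnimodular R s) :
    IsUnimodular R t :=
  top_unique (hs.symm.le.trans (Ideal.span_mono fun _ ⟨f, w, hw, e⟩ => ⟨f, w, h hw, e⟩))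

lemma smul_swap {P : Type*} [AddCommGroup P] [Module R P] [Module.Invertible R P]
    (f : P →ₗ[R] R) (a b : P) : f a • b = f b • a := by
  have h : TensorProduct.comm R P P (a ⊗ₜ b) = a ⊗ₜ b := by
    rw [Module.Invertible.tensorProductComm_eq_refl]; rfl
  have := congrArg (fun t => TensorProduct.lid R P (f.rTensor P t)) h
  simpa using this.symm

/-- A map from a line bundle that vanishes nowhere is a split injection. -/
lemma exists_retraction {P : Type*} [AddCommGroup P] [Module R P] [Module.Invertible R P]
    (μ : P →ₗ[R] M) (h : IsUnimodular R (Set.range μ)) :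
    ∃ ρ : M →ₗ[R] P, ρ ∘ₗ μ = LinearMap.id := by
  have key : ∀ x ∈ Ideal.span {r : R | ∃ f : M →ₗ[R] R, ∃ w ∈ Set.range μ, f w = r},
      ∃ ρ : M →ₗ[R] P, ρ ∘ₗ μ = x • LinearMap.id := by
    intro x hx
    induction hx using Submodule.span_induction with
    | mem x hx =>
      obtain ⟨f, _, ⟨p, rfl⟩, rfl⟩ := hx
      refine ⟨f.smulRight p, LinearMap.ext fun q => ?_⟩
      simpa using smul_swap (f ∘ₗ μ) q p
    | zero => exact ⟨0, by simp⟩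
    | add x y _ _ hx hy =>
      obtain ⟨a, ha⟩ := hx
      obtain ⟨b, hb⟩ := hy
      exact ⟨a + b, by rw [LinearMap.add_comp, ha, hb, add_smul]⟩
    | smul c x _ hx =>
      obtain ⟨a, ha⟩ := hx
      exact ⟨c • a, by rw [LinearMap.smul_comp, ha, smul_assoc]⟩
  obtain ⟨ρ, hρ⟩ := key 1 (by rw [h]; trivial)
  exact ⟨ρ, by simpa using hρ⟩

lemma isLineSubbundle_range [Module.Projective R M] {P : Type*} [AddCommGroup P] [Module R P]
    [Module.Invertible R P] (μ : P →ₗ[R] M) (ρ : M →ₗ[R] P) (h : ρ ∘ₗ μ = LinearMap.id) :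
    IsLineSubbundle (LinearMap.range μ) := by
  have h' : ∀ p, ρ (μ p) = p := fun p => LinearMap.congr_fun h p
  refine ⟨.congr (LinearEquiv.ofInjective μ (Function.LeftInverse.injective h')), ?_⟩
  refine .of_split (Submodule.liftQ (LinearMap.range μ) (LinearMap.id - μ ∘ₗ ρ) ?_)
    (Submodule.mkQ _) ?_
  · rintro _ ⟨p, rfl⟩
    simp [h']
  · ext m
    simp [Submodule.Quotient.mk_sub, (Submodule.Quotient.mk_eq_zero (LinearMap.range μ)).2]

lemma isLineSubbundle_range' [Module.Projective R M] {P : Type*} [AddCommGroup P] [Module R P]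
    [Module.Invertible R P] (μ : P →ₗ[R] M) (h : IsUnimodular R (Set.range μ)) :
    IsLineSubbundle (LinearMap.range μ) := by
  obtain ⟨ρ, hρ⟩ := exists_retraction μ h
  exact isLineSubbundle_range μ ρ hρ

lemma IsLineSubbundle.exists_retraction {W : Submodule R M} (h : IsLineSubbundle W) :
    ∃ ρ : M →ₗ[R] W, ρ ∘ₗ W.subtype = LinearMap.id := by
  have := h.projective_quotient
  obtain ⟨s, hs⟩ := Module.projective_lifting_property W.mkQ LinearMap.id W.mkQ_surjective
  have hs' : ∀ x, W.mkQ (s x) = x := fun x => LinearMap.congr_fun hs x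
  refine ⟨LinearMap.codRestrict W (LinearMap.id - s ∘ₗ W.mkQ) fun m => ?_, ?_⟩
  · rw [← Submodule.Quotient.mk_eq_zero W]
    have := hs' (W.mkQ m)
    simp only [Submodule.mkQ_apply] at this
    simp [Submodule.Quotient.mk_sub, this]
  · ext w
    simp [(Submodule.Quotient.mk_eq_zero W).2 w.2]

lemma IsLineSubbundle.isUnimodular {W : Submodule R M} (h : IsLineSubbundle W) :
    IsUnimodular R (W : Set M) := by
  have := h.invertible
  obtain ⟨ρ, hρ⟩ := h.exists_retraction
  rw [IsUnimodular, Ideal.eq_top_iff_one]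
  suffices ∀ t : Module.Dual R W ⊗[R] W, Module.Invertible.linearEquiv R W t ∈
      Ideal.span {r : R | ∃ f : M →ₗ[R] R, ∃ w ∈ (W : Set M), f w = r} by
    simpa using this ((Module.Invertible.linearEquiv R W).symm 1)
  intro t
  induction t using TensorProduct.induction_on with
  | zero => simp
  | tmul f w =>
    refine Ideal.subset_span ⟨f ∘ₗ ρ, w, w.2, ?_⟩
    have := LinearMap.congr_fun hρ w
    simp only [LinearMap.coe_comp, Function.comp_apply, Submodule.subtype_apply,
      LinearMap.id_apply] at this ⊢
    rw [this]
    simp [Module.Invertible.linearEquiv]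
  | add x y hx hy => rw [map_add]; exact add_mem hx hy

lemma IsLineSubbundle.of_isUnimodular [Module.Projective R M] {W : Submodule R M}
    (hi : Module.Invertible R W) (hu : IsUnimodular R (W : Set M)) : IsLineSubbundle W := by
  have := isLineSubbundle_range' W.subtype (by simpa using hu)
  simpa using this

/-- Extension of scalars of a line bundle along a nowhere vanishing semilinear map. -/
lemma isLineSubbundle_span {R' : Type*} [CommRing R'] (σ : R →+* R') {M' : Type*}
    [AddCommGroup M'] [Module R' M'] [Module.Projective R' M'] (f : M →ₛₗ[σ] M')
    {W : Submodule R M} (hW : Module.Invertible R W) (h : IsUnimodular R' (f '' (W : Set M))) :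
    IsLineSubbundle (Submodule.span R' (f '' (W : Set M))) := by
  let := σ.toAlgebra
  let : Module R M' := Module.compHom M' σ
  have : IsScalarTower R R' M' := ⟨fun r s m => by
    rw [Algebra.smul_def, mul_smul]; rfl⟩
  let g : W →ₗ[R] M' :=
    { toFun := fun w => f w
      map_add' := by simp
      map_smul' := fun r w => by simp; rfl }
  let μ : R' ⊗[R] W →ₗ[R'] M' := g.liftBaseChange R'
  have hr : LinearMap.range μ = Submodule.span R' (f '' (W : Set M)) := by
    rw [LinearMap.range_liftBaseChange]
    congr 1
    ext x
    simp [g]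
  rw [← hr]
  refine isLineSubbundle_range' μ (h.mono ?_)
  rintro _ ⟨w, hw, rfl⟩
  exact ⟨1 ⊗ₜ ⟨w, hw⟩, by simp [μ, g]⟩

/-- If all linear forms extend along a semilinear map, then it preserves unimodularity. -/
lemma IsUnimodular.image {R' : Type*} [CommRing R'] (σ : R →+* R') {M' : Type*}
    [AddCommGroup M'] [Module R' M'] (f : M →ₛₗ[σ] M')
    (hf : ∀ φ : M →ₗ[R] R, ∃ φ' : M' →ₗ[R'] R', ∀ m, φ' (f m) = σ (φ m))
    {s : Set M} (hs : IsUnimodular R s) : IsUnimodular R' (f '' s) := by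
  rw [IsUnimodular, Ideal.eq_top_iff_one] at hs ⊢
  have := Ideal.mem_map_of_mem σ hs
  rw [map_one, Ideal.map_span] at this
  refine Ideal.span_mono ?_ this
  rintro _ ⟨_, ⟨φ, w, hw, rfl⟩, rfl⟩
  obtain ⟨φ', h⟩ := hf φ
  exact ⟨φ', f w, ⟨w, hw, rfl⟩, h w⟩

lemma IsLineSubbundle.span_image {R' : Type*} [CommRing R'] (σ : R →+* R') {M' : Type*}
    [AddCommGroup M'] [Module R' M'] [Module.Projective R' M'] (f : M →ₛₗ[σ] M')
    (hf : ∀ φ : M →ₗ[R] R, ∃ φ' : M' →ₗ[R'] R', ∀ m, φ' (f m) = σ (φ m))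
    {W : Submodule R M} (hW : IsLineSubbundle W) :
    IsLineSubbundle (Submodule.span R' (f '' (W : Set M))) :=
  isLineSubbundle_span σ f hW.invertible (hW.isUnimodular.image σ f hf)

/-- The image of a line sub-bundle under a split injection is a line sub-bundle. -/
lemma IsLineSubbundle.map {Q : Type*} [AddCommGroup Q] [Module R Q] [Module.Projective R Q]
    (j : M →ₗ[R] Q) (ρ : Q →ₗ[R] M) (h : ρ ∘ₗ j = LinearMap.id) {W : Submodule R M}
    (hW : IsLineSubbundle W) : IsLineSubbundle (W.map j) := by
  have := hW.invertible
  obtain ⟨r, hr⟩ := hW.exists_retraction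
  have e : LinearMap.range (j ∘ₗ W.subtype) = W.map j := by
    rw [LinearMap.range_comp, Submodule.range_subtype]
  rw [← e]
  refine isLineSubbundle_range (j ∘ₗ W.subtype) (r ∘ₗ ρ) ?_
  calc (r ∘ₗ ρ) ∘ₗ j ∘ₗ W.subtype = r ∘ₗ (ρ ∘ₗ j) ∘ₗ W.subtype := rfl
    _ = _ := by rw [h, LinearMap.id_comp, hr]

lemma exists_map_iff {Q : Type*} [AddCommGroup Q] [Module R Q] [Module.Projective R Q]
    [Module.Projective R M]
    (j : M →ₗ[R] Q) (ρ : Q →ₗ[R] M) (h : ρ ∘ₗ j = LinearMap.id) (W : Submodule R Q) :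
    (∃ W₀ : Submodule R M, IsLineSubbundle W₀ ∧ W = W₀.map j) ↔
      IsLineSubbundle W ∧ W ≤ LinearMap.range j := by
  constructor
  · rintro ⟨W₀, h₀, rfl⟩
    exact ⟨h₀.map j ρ h, LinearMap.map_le_range⟩
  · rintro ⟨hW, hle⟩
    have h' : ∀ m, ρ (j m) = m := fun m => LinearMap.congr_fun h m
    have hj : ∀ w ∈ W, j (ρ w) = w := by
      intro w hw
      obtain ⟨m, rfl⟩ := hle hw
      rw [h']
    have := hW.invertible
    obtain ⟨r, hr⟩ := hW.exists_retraction
    refine ⟨W.map ρ, ?_, ?_⟩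
    · have e : LinearMap.range (ρ ∘ₗ W.subtype) = W.map ρ := by
        rw [LinearMap.range_comp, Submodule.range_subtype]
      rw [← e]
      refine isLineSubbundle_range (ρ ∘ₗ W.subtype) (r ∘ₗ j) ?_
      ext w
      have := LinearMap.congr_fun hr w
      simp only [LinearMap.coe_comp, Function.comp_apply, Submodule.subtype_apply,
        LinearMap.id_apply] at this ⊢
      rw [hj w w.2, this]
    · ext w
      constructor
      · intro hw
        exact ⟨ρ w, ⟨w, hw, rfl⟩, hj w hw⟩
      · rintro ⟨_, ⟨v, hv, rfl⟩, rfl⟩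
        rwa [hj v hv]

end LineSubbundle

section Curve

/-- A smooth affine curve `X` over `k` together with its smooth compactification: an integral
(equivalently, connected) smooth proper curve `Xbar` over `k` and a nonempty affine open subscheme
`X` of it. -/
structure Curve (k : Type u) [Field k] where
  Xbar : Scheme.{u}
  str : Xbar ⟶ Spec (CommRingCat.of k)
  isIntegral : IsIntegral Xbar
  isProper : IsProper str
  smooth : Smooth str
  dim_eq_one : topologicalKrullDim Xbar = 1
  X : Xbar.Opens
  isAffineOpen : IsAffineOpen X
  nonempty : Nonempty X

attribute [instance] Curve.isIntegral Curve.nonempty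

variable {k : Type u} [Field k] (C : Curve k)

/-- The constants in the ring of functions on an open subset of the curve. -/
def Curve.const (U : C.Xbar.Opens) : k →+* Γ(C.Xbar, U) :=
  ((Scheme.ΓSpecIso (CommRingCat.of k)).inv ≫ C.str.appLE ⊤ U le_top).hom

/-- The coordinate ring `k[X]` of the affine curve `X`. -/
def Curve.coordRing : Type u := Γ(C.Xbar, C.X)

instance : CommRing C.coordRing := inferInstanceAs (CommRing Γ(C.Xbar, C.X))

instance : IsDomain C.coordRing := inferInstanceAs (IsDomain Γ(C.Xbar, C.X))

instance : Algebra k C.coordRing := (C.const C.X).toAlgebra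

/-- A regular function on `X` as a rational function. -/
def Curve.toRat : C.coordRing →+* C.Xbar.functionField := (C.Xbar.germToFunctionField C.X).hom

lemma Curve.toRat_algebraMap (c : k) (x : C.Xbar) :
    C.toRat (algebraMap k C.coordRing c) =
      algebraMap (C.Xbar.presheaf.stalk x) C.Xbar.functionField
        (C.Xbar.presheaf.germ ⊤ x (Opens.mem_top x) (C.const ⊤ c)) := by
  have : Nonempty (⊤ : C.Xbar.Opens) := ⟨⟨x, trivial⟩⟩
  rw [Scheme.algebraMap_germ_eq_germToFunctionField]
  have h : C.const C.X c = C.Xbar.presheaf.map (homOfLE le_top).op (C.const ⊤ c) := by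
    simp only [Curve.const, ← ConcreteCategory.comp_apply]
    change ((Scheme.ΓSpecIso (CommRingCat.of k)).inv ≫ C.str.appLE ⊤ C.X le_top) c =
      (((Scheme.ΓSpecIso (CommRingCat.of k)).inv ≫ C.str.appLE ⊤ ⊤ le_top) ≫
        C.Xbar.presheaf.map (homOfLE le_top).op) c
    rw [Category.assoc]
    congr 2
    exact congrArg _ (Scheme.Hom.appLE_map _ _ _).symm
  change C.Xbar.presheaf.germ C.X _ _ (C.const C.X c) = _
  rw [h, TopCat.Presheaf.germ_res_apply]

/-- `k^d[X]`, the global sections of `𝒪(d D)` on `Xbar`, where `D = Xbar ∖ X` is the reduced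
divisor at infinity: regular functions `f` on `X` with a pole of order at most `d` at
every point `x` of `D`, that is, with `𝔪_x ^ d f ⊆ 𝒪_x`. -/
def Curve.poleSpace (d : ℕ) : Submodule k C.coordRing where
  carrier := {f | ∀ x : C.Xbar, x ∉ C.X →
    ∀ t ∈ IsLocalRing.maximalIdeal (C.Xbar.presheaf.stalk x) ^ d,
      algebraMap (C.Xbar.presheaf.stalk x) C.Xbar.functionField t * C.toRat f ∈
        (algebraMap (C.Xbar.presheaf.stalk x) C.Xbar.functionField).range}
  add_mem' {f g} hf hg x hx t ht := by
    rw [map_add, mul_add]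
    exact add_mem (hf x hx t ht) (hg x hx t ht)
  zero_mem' x hx t ht := by
    rw [map_zero, mul_zero]
    exact zero_mem _
  smul_mem' c f hf x hx t ht := by
    rw [Algebra.smul_def, map_mul, C.toRat_algebraMap c x, mul_left_comm]
    exact mul_mem ⟨_, rfl⟩ (hf x hx t ht)

lemma Curve.poleSpace_mono : Monotone C.poleSpace := fun _ _ h _ hf x hx t ht =>
  hf x hx t (Ideal.pow_le_pow_right h ht)

lemma Curve.one_mem_poleSpace : (1 : C.coordRing) ∈ C.poleSpace 0 := fun x hx t _ => by
  rw [map_one, mul_one]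
  exact ⟨t, rfl⟩

lemma Curve.mul_mem_poleSpace {d e : ℕ} {f g : C.coordRing} (hf : f ∈ C.poleSpace d)
    (hg : g ∈ C.poleSpace e) : f * g ∈ C.poleSpace (d + e) := by
  intro x hx t ht
  rw [pow_add] at ht
  induction ht using Submodule.mul_induction_on' with
  | mem_mul_mem a ha b hb =>
    rw [map_mul, map_mul, mul_mul_mul_comm]
    exact mul_mem (hf x hx a ha) (hg x hx b hb)
  | add a _ b _ ha hb =>
    rw [map_add, add_mul]
    exact add_mem ha hb

end Curve

section Site

/-- The category of affine schemes of finite type over `k`, as the opposite of the category of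
finitely generated commutative `k`-algebras. -/
abbrev Aff (k : Type u) [Field k] : Type (u + 1) := (FGAlgCat.{u} k)ᵒᵖ

variable {k : Type u} [Field k]

/-- The affine scheme `Spec R`. -/
abbrev Aff.spec (R : Type u) [CommRing R] [Algebra k R] [h : Algebra.FiniteType k R] : Aff k :=
  op ⟨CommAlgCat.of k R, h⟩

/-- The ring of functions on an affine scheme (regarded as an object of the opposite category). -/
abbrev fn (S : (Aff k)ᵒᵖ) : Type u := S.unop.unop.obj

/-- The pull back of functions. -/
abbrev pb {S T : (Aff k)ᵒᵖ} (f : S ⟶ T) : fn S →ₐ[k] fn T := f.unop.unop.hom.hom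

/-- The map of affine schemes given by `φ : R → R'` is the inclusion of the basic open subset on
which `r` does not vanish. -/
def IsBasicOpen {R R' : Type*} [CommRing R] [CommRing R'] (φ : R →+* R') (r : R) : Prop :=
  letI := φ.toAlgebra
  IsLocalization.Away r R'

lemma isBasicOpen_id (R : Type*) [CommRing R] : IsBasicOpen (RingHom.id R) 1 :=
  IsLocalization.away_of_isUnit_of_bijective (R := R) R isUnit_one Function.bijective_id

lemma isBasicOpen_algebraMap {R : Type*} [CommRing R] (r : R) :
    IsBasicOpen (algebraMap R (Localization.Away r)) r := by
  have h : (algebraMap R (Localization.Away r)).toAlgebra =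
      (inferInstance : Algebra R (Localization.Away r)) :=
    Algebra.algebra_ext _ _ fun _ => rfl
  rw [IsBasicOpen, h]
  infer_instance

lemma IsBasicOpen.exists_lift {R R' R'' : Type*} [CommRing R] [CommRing R'] [CommRing R'']
    [Algebra k R] [Algebra k R'] [Algebra k R''] {φ : R →ₐ[k] R'} {r : R}
    (h : IsBasicOpen φ.toRingHom r) (ψ : R →ₐ[k] R'') (hr : IsUnit (ψ r)) :
    ∃ l : R' →ₐ[k] R'', l.comp φ = ψ := by
  let := φ.toRingHom.toAlgebra
  have : IsLocalization.Away r R' := h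
  refine ⟨{ toRingHom := IsLocalization.Away.lift r (g := ψ.toRingHom) hr, commutes' := ?_ }, ?_⟩
  · intro c
    rw [← φ.commutes c]
    exact (IsLocalization.Away.lift_eq r (g := ψ.toRingHom) hr _).trans (ψ.commutes c)
  · ext x
    exact IsLocalization.Away.lift_eq r (g := ψ.toRingHom) hr x

lemma IsBasicOpen.exists_prime {R R' : Type*} [CommRing R] [CommRing R'] {φ : R →+* R'} {r : R}
    (h : IsBasicOpen φ r) (p : PrimeSpectrum R) (hp : r ∉ p.asIdeal) :
    ∃ q : PrimeSpectrum R', PrimeSpectrum.comap φ q = p := by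
  let := φ.toAlgebra
  have : IsLocalization.Away r R' := h
  have hp' : p ∈ Set.range (PrimeSpectrum.comap (algebraMap R R')) := by
    rw [PrimeSpectrum.localization_away_comap_range R' r]
    exact hp
  exact hp'

lemma IsBasicOpen.comp {R R' R'' : Type*} [CommRing R] [CommRing R'] [CommRing R'']
    {φ : R →+* R'} {r : R} (h : IsBasicOpen φ r) {ψ : R' →+* R''} {s : R'}
    (h' : IsBasicOpen ψ s) (q : PrimeSpectrum R') (hr : r ∉ (PrimeSpectrum.comap φ q).asIdeal)
    (hs : s ∉ q.asIdeal) :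
    ∃ a : R, a ∉ (PrimeSpectrum.comap φ q).asIdeal ∧ IsBasicOpen (ψ.comp φ) a := by
  let := φ.toAlgebra
  let := ψ.toAlgebra
  let := (ψ.comp φ).toAlgebra
  have : IsScalarTower R R' R'' := .of_algebraMap_eq' rfl
  have : IsLocalization.Away r R' := h
  have : IsLocalization.Away s R'' := h'
  obtain ⟨⟨a, n⟩, ha⟩ := IsLocalization.surj (Submonoid.powers r) s
  have hn : IsUnit (algebraMap R R' n) := IsLocalization.map_units _ n
  have : IsLocalization.Away (algebraMap R R' a) R'' :=
    IsLocalization.Away.of_associated ⟨hn.unit, ha⟩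
  refine ⟨r * a, ?_, IsLocalization.Away.mul' R' R'' r a⟩
  intro hmem
  refine ((PrimeSpectrum.comap φ q).2.mem_or_mem hmem).elim hr fun hap => ?_
  have : s * algebraMap R R' n ∈ q.asIdeal := ha ▸ hap
  exact (q.2.mem_or_mem this).elim hs fun hh =>
    q.2.ne_top (Ideal.eq_top_of_isUnit_mem _ hh hn)

lemma finiteType_away {R : Type*} [CommRing R] [Algebra k R] [Algebra.FiniteType k R] (r : R) :
    Algebra.FiniteType k (Localization.Away r) :=
  Algebra.FiniteType.trans (S := R) inferInstance inferInstance

/-- The Zariski topology: a sieve on `S` is covering if and only if every point of `S` has a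
basic open neighbourhood whose inclusion into `S` belongs to the sieve. -/
def zariski (k : Type u) [Field k] : GrothendieckTopology (Aff k) where
  sieves S := {T | ∀ p : PrimeSpectrum (fn (op S)), ∃ r : fn (op S), r ∉ p.asIdeal ∧
    ∃ (O : Aff k) (j : O ⟶ S), IsBasicOpen (pb j.op).toRingHom r ∧ T j}
  top_mem' S p := ⟨1, p.2.one_notMem, S, 𝟙 S, isBasicOpen_id _, trivial⟩
  pullback_stable' S S' T f hT p := by
    obtain ⟨r, hr, O, j, hj, hTj⟩ := hT (PrimeSpectrum.comap (pb f.op).toRingHom p)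
    have hft := finiteType_away (k := k) (pb f.op r)
    obtain ⟨l, hl⟩ := hj.exists_lift ((IsScalarTower.toAlgHom k (fn (op S'))
      (Localization.Away (pb f.op r))).comp (pb f.op))
      (IsLocalization.Away.algebraMap_isUnit (S := Localization.Away (pb f.op r)) (pb f.op r))
    let O' : Aff k := Aff.spec (Localization.Away (pb f.op r))
    let j' : O' ⟶ S' := Quiver.Hom.op (ObjectProperty.homMk (CommAlgCat.ofHom
      (IsScalarTower.toAlgHom k (fn (op S')) (Localization.Away (pb f.op r)))))
    let l' : O' ⟶ O := Quiver.Hom.op (ObjectProperty.homMk (CommAlgCat.ofHom l))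
    have e : j' ≫ f = l' ≫ j := by
      apply Quiver.Hom.unop_inj
      ext x
      exact (DFunLike.congr_fun hl x).symm
    refine ⟨pb f.op r, hr, O', j', isBasicOpen_algebraMap _, ?_⟩
    change T (j' ≫ f)
    rw [e]
    exact T.downward_closed hTj l'
  transitive' S T hT T' h p := by
    obtain ⟨r, hr, O, j, hj, hTj⟩ := hT p
    obtain ⟨q, rfl⟩ := hj.exists_prime p hr
    obtain ⟨s, hs, O', j', hj', hT'⟩ := h hTj q
    obtain ⟨a, ha, hb⟩ := hj.comp hj' q hr hs
    exact ⟨a, ha, O', j' ≫ j, hb, hT'⟩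

instance : HasSheafify (zariski k) (Type u) := hasSheafifyEssentiallySmallSite.{u} _ _

end Site

section Extension

/-- Apply a ring homomorphism to all the coordinates of a vector. -/
def coordMap (N : ℕ) {B B' : Type*} [CommRing B] [CommRing B'] (σ : B →+* B') :
    (Fin N → B) →ₛₗ[σ] (Fin N → B') where
  toFun v i := σ (v i)
  map_add' v w := by ext; simp
  map_smul' c v := by ext; simp

lemma span_image_span {R R' M M' : Type*} [CommRing R] [CommRing R'] [AddCommGroup M]
    [AddCommGroup M'] [Module R M] [Module R' M'] {σ : R →+* R'} (f : M →ₛₗ[σ] M') (s : Set M) :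
    Submodule.span R' (f '' (Submodule.span R s : Set M)) = Submodule.span R' (f '' s) := by
  refine le_antisymm (Submodule.span_le.2 ?_)
    (Submodule.span_mono (Set.image_mono Submodule.subset_span))
  rintro _ ⟨x, hx, rfl⟩
  induction hx using Submodule.span_induction with
  | mem x hx => exact Submodule.subset_span ⟨x, hx, rfl⟩
  | zero => simp
  | add x y _ _ hx hy => rw [map_add]; exact add_mem hx hy
  | smul c x _ hx => rw [map_smulₛₗ]; exact Submodule.smul_mem _ _ hx

/-- The extension of a submodule of `B ^ N` along a ring homomorphism `B → B'`: the submodule of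
`B' ^ N` generated by its image. -/
def extend {N : ℕ} {B B' : Type*} [CommRing B] [CommRing B'] (σ : B →+* B')
    (W : Submodule B (Fin N → B)) : Submodule B' (Fin N → B') :=
  Submodule.span B' (coordMap N σ '' (W : Set (Fin N → B)))

lemma extend_id {N : ℕ} {B : Type*} [CommRing B] (W : Submodule B (Fin N → B)) :
    extend (RingHom.id B) W = W := by
  have : coordMap N (RingHom.id B) '' (W : Set (Fin N → B)) = W := by
    ext x
    constructor
    · rintro ⟨y, hy, rfl⟩
      exact hy
    · intro hx
      exact ⟨x, hx, rfl⟩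
  rw [extend, this, Submodule.span_eq]

lemma extend_extend {N : ℕ} {B B' B'' : Type*} [CommRing B] [CommRing B'] [CommRing B'']
    (σ : B →+* B') (τ : B' →+* B'') (W : Submodule B (Fin N → B)) :
    extend τ (extend σ W) = extend (τ.comp σ) W := by
  rw [extend, extend, span_image_span, Set.image_image]
  rfl

lemma coordMap_extends {N : ℕ} {B B' : Type*} [CommRing B] [CommRing B'] (σ : B →+* B')
    (φ : (Fin N → B) →ₗ[B] B) :
    ∃ φ' : (Fin N → B') →ₗ[B'] B', ∀ v, φ' (coordMap N σ v) = σ (φ v) := by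
  refine ⟨∑ i, σ (φ (Pi.single i 1)) • LinearMap.proj i, fun v => ?_⟩
  rw [LinearMap.pi_apply_eq_sum_univ φ v]
  simp only [LinearMap.sum_apply, LinearMap.smul_apply, LinearMap.proj_apply, smul_eq_mul,
    map_sum, map_mul, coordMap, LinearMap.coe_mk, AddHom.coe_mk]
  refine Finset.sum_congr rfl fun i _ => ?_
  rw [mul_comm]
  congr 3
  ext j
  simp [Pi.single_apply, eq_comm]

lemma IsLineSubbundle.extend {N : ℕ} {B B' : Type*} [CommRing B] [CommRing B'] (σ : B →+* B')
    {W : Submodule B (Fin N → B)} (h : IsLineSubbundle W) :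
    IsLineSubbundle (GenericLines.extend σ W) :=
  h.span_image σ (coordMap N σ) (coordMap_extends σ)

end Extension

section SubbundleOnOpen

/-- A line sub-bundle of the trivial bundle of rank `N` on an open subset `U` of `Spec B`. As a
subsheaf of `𝒪_U ^ N` it is given by its stalks, and every point of `U` has a basic open
neighbourhood `D(b)` in `U` on which it comes from a line sub-bundle of the free module of rank `N`
over the ring `B_b` of functions on `D(b)` (every submodule of `B_b ^ N` is the extension
of a submodule `W` of `B ^ N`). -/
@[ext]
structure LineSubbundle (N : ℕ) {B : Type u} [CommRing B] (U : Opens (PrimeSpectrum B)) where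
  stalk : ∀ q : PrimeSpectrum B, q ∈ U →
    Submodule (Localization.AtPrime q.asIdeal) (Fin N → Localization.AtPrime q.asIdeal)
  locally_eq : ∀ q ∈ U, ∃ b : B, b ∉ q.asIdeal ∧ PrimeSpectrum.basicOpen b ≤ U ∧
    ∃ W : Submodule B (Fin N → B),
      IsLineSubbundle (extend (algebraMap B (Localization.Away b)) W) ∧
      ∀ (q' : PrimeSpectrum B) (hq' : q' ∈ U), b ∉ q'.asIdeal →
        stalk q' hq' = extend (algebraMap B (Localization.AtPrime q'.asIdeal)) W

/-- The pull back of a line sub-bundle along `Spec B' → Spec B`. -/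
def LineSubbundle.pullback {N : ℕ} {B B' : Type u} [CommRing B] [CommRing B'] (σ : B →+* B')
    {U : Opens (PrimeSpectrum B)} (l : LineSubbundle N U) :
    LineSubbundle N (Opens.comap ⟨PrimeSpectrum.comap σ, PrimeSpectrum.continuous_comap σ⟩ U) where
  stalk q hq := extend
    (Localization.localRingHom (PrimeSpectrum.comap σ q).asIdeal q.asIdeal σ rfl)
    (l.stalk (PrimeSpectrum.comap σ q) hq)
  locally_eq q hq := by
    obtain ⟨b, hb, hbU, W, hW, h⟩ := l.locally_eq (PrimeSpectrum.comap σ q) hq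
    refine ⟨σ b, hb, fun q' hq' => hbU hq', extend σ W, ?_, ?_⟩
    · have hu : IsUnit (((algebraMap B' (Localization.Away (σ b))).comp σ) b) :=
        IsLocalization.Away.algebraMap_isUnit (σ b)
      have := hW.extend (IsLocalization.Away.lift b hu)
      rw [extend_extend, IsLocalization.Away.lift_comp] at this
      rwa [extend_extend]
    · intro q' hq' hb'
      rw [h (PrimeSpectrum.comap σ q') hq' hb', extend_extend, extend_extend]
      congr 1
      exact RingHom.ext fun x =>
        Localization.localRingHom_to_map (PrimeSpectrum.comap σ q').asIdeal q'.asIdeal σ rfl x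

end SubbundleOnOpen

section GenericLine

variable {k : Type u} [Field k]

/-- An open subset `U` of `S × X`, where `S = Spec R` and `X = Spec A`, is a domain if it surjects
onto `S`. -/
def IsDomainOpen {R A : Type u} [CommRing R] [CommRing A] [Algebra k R] [Algebra k A]
    (U : Opens (PrimeSpectrum (R ⊗[k] A))) : Prop :=
  ∀ p : PrimeSpectrum R, ∃ q ∈ U, PrimeSpectrum.comap (algebraMap R (R ⊗[k] A)) q = p

/-- The map of rings of functions induced by `S' × X → S × X`. -/
abbrev bcRing {R R' : Type u} [CommRing R] [CommRing R'] [Algebra k R] [Algebra k R']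
    (A : Type u) [CommRing A] [Algebra k A] (φ : R →ₐ[k] R') : R ⊗[k] A →ₐ[k] R' ⊗[k] A :=
  Algebra.TensorProduct.map φ (AlgHom.id k A)

lemma exists_ringHom {R R' A T : Type u} [CommRing R] [CommRing R'] [CommRing A] [CommRing T]
    [Algebra k R] [Algebra k R'] [Algebra k A] (φ : R →ₐ[k] R') (g₁ : R' →+* T)
    (g₂ : R ⊗[k] A →+* T) (hg : ∀ r : R, g₁ (φ r) = g₂ (r ⊗ₜ 1)) :
    ∃ G : R' ⊗[k] A →+* T, G.comp (algebraMap R' (R' ⊗[k] A)) = g₁ ∧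
      G.comp (bcRing A φ).toRingHom = g₂ := by
  let := (g₁.comp (algebraMap k R')).toAlgebra
  let G₁ : R' →ₐ[k] T := { g₁ with commutes' := fun _ => rfl }
  let G₂ : A →ₐ[k] T :=
    { g₂.comp (Algebra.TensorProduct.includeRight : A →ₐ[k] R ⊗[k] A).toRingHom with
      commutes' := fun c => by
        change g₂ ((Algebra.TensorProduct.includeRight : A →ₐ[k] R ⊗[k] A) (algebraMap k A c)) =
          g₁ (algebraMap k R' c)
        rw [AlgHom.commutes, Algebra.TensorProduct.algebraMap_apply, ← hg, AlgHom.commutes] }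
  let G : R' ⊗[k] A →ₐ[k] T := Algebra.TensorProduct.lift G₁ G₂ fun _ _ => Commute.all _ _
  have hG : ∀ r a, G (r ⊗ₜ a) = g₁ r * g₂ (1 ⊗ₜ a) := fun r a =>
    Algebra.TensorProduct.lift_tmul _ _ _ _ _
  refine ⟨G.toRingHom, RingHom.ext fun x => ?_, RingHom.ext fun x => ?_⟩
  · change G (x ⊗ₜ 1) = g₁ x
    rw [hG, ← Algebra.TensorProduct.one_def, map_one, mul_one]
  · induction x using TensorProduct.induction_on with
    | zero => simp
    | add x y hx hy => rw [map_add, map_add, hx, hy]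
    | tmul r a =>
      change G (φ r ⊗ₜ a) = g₂ (r ⊗ₜ a)
      rw [hG, hg, ← map_mul, Algebra.TensorProduct.tmul_mul_tmul, mul_one, one_mul]

lemma IsDomainOpen.comap {R R' A : Type u} [CommRing R] [CommRing R'] [CommRing A]
    [Algebra k R] [Algebra k R'] [Algebra k A] (φ : R →ₐ[k] R')
    {U : Opens (PrimeSpectrum (R ⊗[k] A))} (hU : IsDomainOpen U) :
    IsDomainOpen (Opens.comap ⟨PrimeSpectrum.comap (bcRing A φ).toRingHom,
      PrimeSpectrum.continuous_comap _⟩ U) := by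
  intro p'
  obtain ⟨q, hqU, hq⟩ := hU (PrimeSpectrum.comap φ.toRingHom p')
  let p := PrimeSpectrum.comap φ.toRingHom p'
  let K₀ := p.asIdeal.ResidueField
  let K₁ := p'.asIdeal.ResidueField
  let K₂ := q.asIdeal.ResidueField
  let f₁ : K₀ →+* K₁ := Ideal.ResidueField.map p.asIdeal p'.asIdeal φ.toRingHom rfl
  let f₂ : K₀ →+* K₂ := Ideal.ResidueField.map p.asIdeal q.asIdeal (algebraMap R (R ⊗[k] A))
    (congrArg PrimeSpectrum.asIdeal hq.symm)
  let := f₁.toAlgebra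
  let := f₂.toAlgebra
  let T := K₁ ⊗[K₀] K₂
  obtain ⟨t⟩ : Nonempty (PrimeSpectrum T) := inferInstance
  let g₁ : R' →+* T := (algebraMap K₁ T).comp (algebraMap R' K₁)
  let g₂ : R ⊗[k] A →+* T :=
    (Algebra.TensorProduct.includeRight : K₂ →ₐ[K₀] T).toRingHom.comp (algebraMap (R ⊗[k] A) K₂)
  have hg : ∀ r : R, g₁ (φ r) = g₂ (r ⊗ₜ 1) := by
    intro r
    have h₁ : algebraMap R' K₁ (φ r) = algebraMap K₀ K₁ (algebraMap R K₀ r) :=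
      (Ideal.ResidueField.map_algebraMap _ _ _ _ _).symm
    have h₂ : algebraMap (R ⊗[k] A) K₂ (r ⊗ₜ 1) = algebraMap K₀ K₂ (algebraMap R K₀ r) :=
      (Ideal.ResidueField.map_algebraMap p.asIdeal q.asIdeal (algebraMap R (R ⊗[k] A))
        (congrArg PrimeSpectrum.asIdeal hq.symm) r).symm
    change algebraMap K₁ T (algebraMap R' K₁ (φ r)) =
      (Algebra.TensorProduct.includeRight : K₂ →ₐ[K₀] T) (algebraMap (R ⊗[k] A) K₂ (r ⊗ₜ 1))
    rw [h₁, h₂, AlgHom.commutes, ← IsScalarTower.algebraMap_apply]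
  obtain ⟨G, hG', hG⟩ := exists_ringHom φ g₁ g₂ hg
  have field_comap : ∀ {D K : Type u} [CommRing D] [Field K] (f : K →+* T) (g : D →+* K),
      (PrimeSpectrum.comap (f.comp g) t).asIdeal = RingHom.ker g := by
    intro D K _ _ f g
    have : (PrimeSpectrum.comap f t).asIdeal = ⊥ :=
      (Ideal.eq_bot_or_top _).resolve_right (PrimeSpectrum.comap f t).2.ne_top
    ext x
    rw [PrimeSpectrum.comap_comp_apply, PrimeSpectrum.comap_asIdeal, this]
    rfl
  refine ⟨PrimeSpectrum.comap G t, ?_, ?_⟩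
  · change PrimeSpectrum.comap (bcRing A φ).toRingHom (PrimeSpectrum.comap G t) ∈ U
    rw [← PrimeSpectrum.comap_comp_apply, hG]
    convert! hqU
    ext1
    rw [field_comap, Ideal.ker_algebraMap_residueField]
  · rw [← PrimeSpectrum.comap_comp_apply, hG']
    ext1
    rw [field_comap, Ideal.ker_algebraMap_residueField]

/-- A line sub-bundle of the trivial bundle of rank `N` defined on some domain in
`S × X`, where `S = Spec R` and `X = Spec A`. -/
structure LineOnDomain (k : Type u) [Field k] (N : ℕ) (R A : Type u) [CommRing R] [CommRing A]
    [Algebra k R] [Algebra k A] where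
  U : Opens (PrimeSpectrum (R ⊗[k] A))
  isDomainOpen : IsDomainOpen U
  line : LineSubbundle N U

/-- `l'` is the restriction of `l` to a sub-domain. -/
def LineOnDomain.IsRestriction {N : ℕ} {R A : Type u} [CommRing R] [CommRing A]
    [Algebra k R] [Algebra k A] (l l' : LineOnDomain k N R A) : Prop :=
  ∃ h : l'.U ≤ l.U, ∀ (q : PrimeSpectrum (R ⊗[k] A)) (hq : q ∈ l'.U),
    l'.line.stalk q hq = l.line.stalk q (h hq)

/-- Generic lines over `S = Spec R`: the colimit, over all domains `U` in `S × X`, of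
the sets of line sub-bundles of the trivial bundle of rank `N` on `U`. -/
def GenericLine (k : Type u) [Field k] (N : ℕ) (R A : Type u) [CommRing R] [CommRing A]
    [Algebra k R] [Algebra k A] : Type u :=
  Quot (LineOnDomain.IsRestriction (k := k) (N := N) (R := R) (A := A))

/-- The pull back of a line sub-bundle on a domain in `S × X` along `S' → S`. -/
def LineOnDomain.pullback {N : ℕ} {R R' A : Type u} [CommRing R] [CommRing R'] [CommRing A]
    [Algebra k R] [Algebra k R'] [Algebra k A] (φ : R →ₐ[k] R') (l : LineOnDomain k N R A) :
    LineOnDomain k N R' A where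
  U := _
  isDomainOpen := l.isDomainOpen.comap φ
  line := l.line.pullback (bcRing A φ).toRingHom

/-- The pull back of generic lines along `S' → S`. -/
def GenericLine.pullback {N : ℕ} {R R' A : Type u} [CommRing R] [CommRing R'] [CommRing A]
    [Algebra k R] [Algebra k R'] [Algebra k A] (φ : R →ₐ[k] R') :
    GenericLine k N R A → GenericLine k N R' A :=
  Quot.map (LineOnDomain.pullback φ) fun _ _ ⟨h, h'⟩ =>
    ⟨fun _ hq => h hq, fun _ hq => congrArg (extend _) (h' _ hq)⟩

lemma LineOnDomain.isRestriction_pullback_of_eq {N : ℕ} {R A : Type u} [CommRing R] [CommRing A]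
    [Algebra k R] [Algebra k A] (σ : R ⊗[k] A →+* R ⊗[k] A) (hσ : σ = RingHom.id _)
    (l : LineOnDomain k N R A) (l' : LineOnDomain k N R A)
    (hU : ∀ q, q ∈ l'.U ↔ PrimeSpectrum.comap σ q ∈ l.U)
    (hl : ∀ q (hq : q ∈ l'.U), l'.line.stalk q hq =
      (l.line.pullback σ).stalk q ((hU q).1 hq)) : l.IsRestriction l' := by
  subst hσ
  refine ⟨fun q hq => (hU q).1 hq, fun q hq => ?_⟩
  rw [hl]
  change extend (Localization.localRingHom q.asIdeal q.asIdeal (RingHom.id _) rfl)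
    (l.line.stalk q _) = _
  rw [Localization.localRingHom_id, extend_id]

lemma GenericLine.pullback_id {N : ℕ} {R A : Type u} [CommRing R] [CommRing A]
    [Algebra k R] [Algebra k A] (l : GenericLine k N R A) :
    l.pullback (AlgHom.id k R) = l := by
  obtain ⟨l, rfl⟩ := Quot.exists_rep l
  refine (Quot.sound ?_).symm
  refine LineOnDomain.isRestriction_pullback_of_eq (bcRing A (AlgHom.id k R)).toRingHom ?_ l _
    (fun _ => Iff.rfl) (fun _ _ => rfl)
  rw [bcRing, Algebra.TensorProduct.map_id]
  rfl

lemma LineOnDomain.isRestriction_pullback_comp {N : ℕ} {R R' R'' A : Type u} [CommRing R]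
    [CommRing R'] [CommRing R''] [CommRing A] [Algebra k R] [Algebra k R'] [Algebra k R'']
    [Algebra k A] (σ : R ⊗[k] A →+* R' ⊗[k] A) (τ : R' ⊗[k] A →+* R'' ⊗[k] A)
    (υ : R ⊗[k] A →+* R'' ⊗[k] A) (h : υ = τ.comp σ) (l : LineOnDomain k N R A)
    (l' l'' : LineOnDomain k N R'' A)
    (hU' : ∀ q, q ∈ l'.U ↔ PrimeSpectrum.comap υ q ∈ l.U)
    (hl' : ∀ q (hq : q ∈ l'.U), l'.line.stalk q hq =
      (l.line.pullback υ).stalk q ((hU' q).1 hq))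
    (hU'' : ∀ q, q ∈ l''.U ↔ PrimeSpectrum.comap σ (PrimeSpectrum.comap τ q) ∈ l.U)
    (hl'' : ∀ q (hq : q ∈ l''.U), l''.line.stalk q hq =
      ((l.line.pullback σ).pullback τ).stalk q ((hU'' q).1 hq)) : l'.IsRestriction l'' := by
  subst h
  refine ⟨fun q hq => (hU' q).2 ((hU'' q).1 hq), fun q hq => ?_⟩
  rw [hl', hl'']
  change extend _ (extend _ _) = _
  rw [extend_extend]
  refine congrArg (fun f => extend f _) ?_
  exact (Localization.localRingHom_comp _ _ _ _ _ _ _).symm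

lemma GenericLine.pullback_comp {N : ℕ} {R R' R'' A : Type u} [CommRing R]
    [CommRing R'] [CommRing R''] [CommRing A] [Algebra k R] [Algebra k R'] [Algebra k R'']
    [Algebra k A] (φ : R →ₐ[k] R') (ψ : R' →ₐ[k] R'') (l : GenericLine k N R A) :
    l.pullback (ψ.comp φ) = (l.pullback φ).pullback ψ := by
  obtain ⟨l, rfl⟩ := Quot.exists_rep l
  refine Quot.sound ?_
  refine LineOnDomain.isRestriction_pullback_comp (bcRing A φ).toRingHom (bcRing A ψ).toRingHom
    (bcRing A (ψ.comp φ)).toRingHom ?_ l _ _ (fun _ => Iff.rfl) (fun _ _ => rfl)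
    (fun _ => Iff.rfl) (fun _ _ => rfl)
  refine RingHom.ext fun x => ?_
  induction x using TensorProduct.induction_on with
  | zero => simp
  | add x y hx hy => rw [map_add, map_add, hx, hy]
  | tmul r a => rfl

/-- The presheaf `𝓛` of generic lines in the trivial bundle of rank `N` on the curve `X`. -/
def genericLines (C : Curve k) (N : ℕ) : (Aff k)ᵒᵖ ⥤ Type u where
  obj S := GenericLine k N (fn S) C.coordRing
  map f := ↾(GenericLine.pullback (pb f))
  map_id S := by
    ext l
    exact GenericLine.pullback_id l
  map_comp f g := by
    ext l
    exact GenericLine.pullback_comp (pb f) (pb g) l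

end GenericLine

section ProjectiveSpace

variable {k : Type u} [Field k]

/-- The map `R ⊗ V → R' ⊗ V` induced by `φ : R → R'`. -/
def bcVec {R R' : Type u} [CommRing R] [CommRing R'] [Algebra k R] [Algebra k R']
    (V : Type u) [AddCommGroup V] [Module k V] (φ : R →ₐ[k] R') :
    R ⊗[k] V →ₛₗ[φ.toRingHom] R' ⊗[k] V where
  toFun := TensorProduct.map φ.toLinearMap LinearMap.id
  map_add' := map_add _
  map_smul' r x := by
    induction x using TensorProduct.induction_on with
    | zero => simp
    | add x y hx hy => rw [smul_add, map_add, hx, hy, map_add, smul_add]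
    | tmul s v => simp [TensorProduct.smul_tmul']

lemma bcVec_tmul {R R' : Type u} [CommRing R] [CommRing R'] [Algebra k R] [Algebra k R']
    (V : Type u) [AddCommGroup V] [Module k V] (φ : R →ₐ[k] R') (r : R) (v : V) :
    bcVec V φ (r ⊗ₜ v) = φ r ⊗ₜ v := rfl

lemma bcVec_id {R : Type u} [CommRing R] [Algebra k R] (V : Type u) [AddCommGroup V]
    [Module k V] (x : R ⊗[k] V) : bcVec V (AlgHom.id k R) x = x := by
  induction x using TensorProduct.induction_on with
  | zero => simp only [map_zero]
  | add x y hx hy => rw [map_add, hx, hy]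
  | tmul s v => rfl

lemma bcVec_comp {R R' R'' : Type u} [CommRing R] [CommRing R'] [CommRing R''] [Algebra k R]
    [Algebra k R'] [Algebra k R''] (V : Type u) [AddCommGroup V] [Module k V] (φ : R →ₐ[k] R')
    (ψ : R' →ₐ[k] R'') (x : R ⊗[k] V) : bcVec V (ψ.comp φ) x = bcVec V ψ (bcVec V φ x) := by
  induction x using TensorProduct.induction_on with
  | zero => simp only [map_zero]
  | add x y hx hy => rw [map_add, map_add, map_add, hx, hy]
  | tmul s v => rfl

lemma bcVec_baseChange {R R' : Type u} [CommRing R] [CommRing R'] [Algebra k R] [Algebra k R']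
    {V V' : Type u} [AddCommGroup V] [Module k V] [AddCommGroup V'] [Module k V']
    (j : V →ₗ[k] V') (φ : R →ₐ[k] R') (x : R ⊗[k] V) :
    bcVec V' φ (j.baseChange R x) = j.baseChange R' (bcVec V φ x) := by
  induction x using TensorProduct.induction_on with
  | zero => simp only [map_zero]
  | add x y hx hy => simp only [map_add, hx, hy]
  | tmul s v => rfl

lemma bcVec_extends {R R' : Type u} [CommRing R] [CommRing R'] [Algebra k R] [Algebra k R']
    (V : Type u) [AddCommGroup V] [Module k V] (φ : R →ₐ[k] R') (f : R ⊗[k] V →ₗ[R] R) :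
    ∃ f' : R' ⊗[k] V →ₗ[R'] R', ∀ x, f' (bcVec V φ x) = φ.toRingHom (f x) := by
  let g : V →ₗ[k] R' :=
    φ.toLinearMap ∘ₗ f.restrictScalars k ∘ₗ TensorProduct.mk k R V 1
  refine ⟨g.liftBaseChange R', fun x => ?_⟩
  induction x using TensorProduct.induction_on with
  | zero => simp only [map_zero]
  | add x y hx hy => simp only [map_add, hx, hy]
  | tmul r v =>
    have : (r ⊗ₜ[k] v : R ⊗[k] V) = r • (1 ⊗ₜ v) := by simp [TensorProduct.smul_tmul']
    rw [bcVec_tmul, this, map_smul]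
    simp [g]

/-- The functor of points, on affine schemes of finite type, of the projective space
`ℙ(V)` of lines in a vector space `V`: an `S`-valued point is a line sub-bundle of the
trivial bundle on `S` with fibre `V`. -/
def projSpace (V : Type u) [AddCommGroup V] [Module k V] : (Aff k)ᵒᵖ ⥤ Type u where
  obj S := {W : Submodule (fn S) (fn S ⊗[k] V) // IsLineSubbundle W}
  map {S T} f := ↾fun W =>
    ⟨Submodule.span (fn T) (bcVec V (pb f) '' (W.1 : Set (fn S ⊗[k] V))),
      W.2.span_image _ _ (bcVec_extends V (pb f))⟩
  map_id S := by
    refine ConcreteCategory.hom_ext _ _ fun W => Subtype.ext ?_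
    change Submodule.span (fn S) (bcVec V (AlgHom.id k (fn S)) '' _) = W.1
    simp only [bcVec_id, Set.image_id', Submodule.span_eq]
  map_comp {S T T'} f g := by
    refine ConcreteCategory.hom_ext _ _ fun W => Subtype.ext ?_
    change Submodule.span (fn T') (bcVec V ((pb g).comp (pb f)) '' _) =
      Submodule.span (fn T') (bcVec V (pb g) '' (Submodule.span (fn T)
        (bcVec V (pb f) '' (W.1 : Set (fn S ⊗[k] V))) : Set (fn T ⊗[k] V)))
    rw [span_image_span, Set.image_image]
    simp only [bcVec_comp]

lemma exists_baseChange_retraction (R : Type u) [CommRing R] [Algebra k R] {V V' : Type u}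
    [AddCommGroup V] [Module k V] [AddCommGroup V'] [Module k V'] (j : V →ₗ[k] V')
    (hj : Function.Injective j) :
    ∃ ρ : R ⊗[k] V' →ₗ[R] R ⊗[k] V, ρ ∘ₗ j.baseChange R = LinearMap.id := by
  obtain ⟨r, hr⟩ := LinearMap.exists_leftInverse_of_injective j (LinearMap.ker_eq_bot.2 hj)
  exact ⟨r.baseChange R, by rw [← LinearMap.baseChange_comp, hr, LinearMap.baseChange_id]⟩

/-- The embedding of projective spaces given by an injective linear map. -/
def projSpaceMap {V V' : Type u} [AddCommGroup V] [Module k V] [AddCommGroup V'] [Module k V']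
    (j : V →ₗ[k] V') (hj : Function.Injective j) :
    projSpace (k := k) V ⟶ projSpace V' where
  app S := ↾fun W => ⟨W.1.map (j.baseChange (fn S)), by
    obtain ⟨ρ, hρ⟩ := exists_baseChange_retraction (fn S) j hj
    exact W.2.map _ ρ hρ⟩
  naturality S T f := by
    refine ConcreteCategory.hom_ext _ _ fun W => Subtype.ext ?_
    change Submodule.map (j.baseChange (fn T)) (Submodule.span (fn T) _) =
      Submodule.span (fn T) (bcVec V' (pb f) '' (Submodule.map (j.baseChange (fn S)) W.1 : Set _))
    rw [Submodule.map_span, Submodule.map_coe, Set.image_image, Set.image_image]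
    simp only [bcVec_baseChange]

end ProjectiveSpace

section Points

variable {k : Type u} [Field k] [IsAlgClosed k] {R : Type u} [CommRing R] [Algebra k R]
  [Algebra.FiniteType k R]

lemma exists_point (m : Ideal R) (hm : m.IsMaximal) :
    ∃ χ : R →ₐ[k] k, RingHom.ker χ = m := by
  let := Ideal.Quotient.field m
  have : Module.Finite k (R ⧸ m) := finite_of_finite_type_of_isJacobsonRing k (R ⧸ m)
  let e : k ≃ₐ[k] R ⧸ m := AlgEquiv.ofBijective (Algebra.ofId k (R ⧸ m))
    IsAlgClosed.algebraMap_bijective_of_isIntegral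
  refine ⟨e.symm.toAlgHom.comp (Ideal.Quotient.mkₐ k m), ?_⟩
  ext x
  simp [RingHom.mem_ker, Ideal.Quotient.eq_zero_iff_mem]

/-- A set of vectors is unimodular if and only if it is so at every `k`-point. -/
lemma isUnimodular_iff {Q : Type u} [AddCommGroup Q] [Module R Q] (s : Set Q) :
    IsUnimodular R s ↔
      ∀ χ : R →ₐ[k] k, ∃ w ∈ s, ∃ f : Q →ₗ[R] R, χ (f w) ≠ 0 := by
  constructor
  · intro h χ
    by_contra! hc
    have : Ideal.span {r : R | ∃ f : Q →ₗ[R] R, ∃ w ∈ s, f w = r} ≤ RingHom.ker χ := by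
      rw [Ideal.span_le]
      rintro _ ⟨f, w, hw, rfl⟩
      exact hc w hw f
    rw [h] at this
    exact RingHom.ker_ne_top χ (top_unique this)
  · intro h
    by_contra hc
    obtain ⟨m, hm, hle⟩ := Ideal.exists_le_maximal _ hc
    obtain ⟨χ, rfl⟩ := exists_point (k := k) m hm
    obtain ⟨w, hw, f, hf⟩ := h χ
    exact hf (hle (Ideal.subset_span ⟨f, w, hw, rfl⟩))

end Points

section Fibre

variable {k : Type u} [Field k] {R : Type u} [CommRing R] [Algebra k R]

/-- The restriction of a function on `S × X` to the fibre over a `k`-point of `S`. -/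
def fibre (A : Type u) [CommRing A] [Algebra k A] (χ : R →ₐ[k] k) : R ⊗[k] A →ₐ[k] A :=
  Algebra.TensorProduct.lift ((Algebra.ofId k A).comp χ) (AlgHom.id k A)
    fun _ _ => Commute.all _ _

lemma fibre_tmul {A : Type u} [CommRing A] [Algebra k A] (χ : R →ₐ[k] k) (r : R) (a : A) :
    fibre A χ (r ⊗ₜ a) = χ r • a := by
  rw [fibre, Algebra.TensorProduct.lift_tmul, Algebra.smul_def]
  rfl

lemma fibre_ne_zero_iff {A : Type u} [CommRing A] [Algebra k A] (χ : R →ₐ[k] k)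
    (x : R ⊗[k] A) : (∃ f : R ⊗[k] A →ₗ[R] R, χ (f x) ≠ 0) ↔ fibre A χ x ≠ 0 := by
  constructor
  · rintro ⟨f, hf⟩ h0
    obtain ⟨f', hf'⟩ := bcVec_extends A χ f
    have h1 : ∀ y : R ⊗[k] A, TensorProduct.lid k A (bcVec A χ y) = fibre A χ y := by
      intro y
      induction y using TensorProduct.induction_on with
      | zero => simp only [map_zero]
      | add y z hy hz => simp only [map_add, hy, hz]
      | tmul r a => rw [bcVec_tmul, fibre_tmul, TensorProduct.lid_tmul]
    have h2 : bcVec A χ x = 0 := by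
      rw [← h1] at h0
      exact (LinearEquiv.map_eq_zero_iff _).1 h0
    apply hf
    have := hf' x
    rw [h2, map_zero] at this
    exact this.symm
  · intro h
    obtain ⟨l, hl⟩ : ∃ l : Module.Dual k A, l (fibre A χ x) ≠ 0 := by
      by_contra! hc
      exact h ((Module.forall_dual_apply_eq_zero_iff k _).1 hc)
    refine ⟨l.baseChange R, ?_⟩
    have : ∀ y : R ⊗[k] A, χ (l.baseChange R y) = l (fibre A χ y) := by
      intro y
      induction y using TensorProduct.induction_on with
      | zero => simp only [map_zero]
      | add y z hy hz => simp only [map_add, hy, hz]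
      | tmul r a => simp [fibre_tmul, mul_comm]
    simpa [this] using hl

lemma fibre_ne_zero_iff_pi {A : Type u} [CommRing A] [Algebra k A] {N : ℕ} (χ : R →ₐ[k] k)
    (v : Fin N → R ⊗[k] A) : (∃ f : (Fin N → R ⊗[k] A) →ₗ[R] R, χ (f v) ≠ 0) ↔
      ∃ i, fibre A χ (v i) ≠ 0 := by
  constructor
  · rintro ⟨f, hf⟩
    by_contra! hc
    apply hf
    rw [← Finset.univ_sum_single v, map_sum, map_sum]
    refine Finset.sum_eq_zero fun i _ => ?_
    by_contra h
    exact (fibre_ne_zero_iff χ (v i)).1 ⟨f ∘ₗ LinearMap.single R (fun _ => R ⊗[k] A) i, h⟩ (hc i)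
  · rintro ⟨i, hi⟩
    obtain ⟨f, hf⟩ := (fibre_ne_zero_iff χ (v i)).2 hi
    exact ⟨f ∘ₗ LinearMap.proj i, hf⟩

end Fibre

section Product

variable {R : Type u} [CommRing R] {B : Type u} [CommRing B] [Algebra R B]

lemma IsLineSubbundle.smul {Q : Type u} [AddCommGroup Q] [Module R Q] [Module B Q]
    [IsScalarTower R B Q] [Module.Projective R Q] {W₁ : Submodule R B} {W₂ : Submodule R Q}
    (h₁ : IsLineSubbundle W₁) (h₂ : IsLineSubbundle W₂)
    (h : IsUnimodular R {x : Q | ∃ a ∈ W₁, ∃ v ∈ W₂, a • v = x}) :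
    IsLineSubbundle (W₁ • W₂) := by
  have := h₁.invertible
  have := h₂.invertible
  let μ : W₁ ⊗[R] W₂ →ₗ[R] Q :=
    TensorProduct.lift ((Algebra.lsmul R R Q).toLinearMap.domRestrict₁₂ W₁ W₂)
  have hμ : ∀ a v, μ (a ⊗ₜ v) = (a : B) • (v : Q) := fun a v => rfl
  have hr : LinearMap.range μ = W₁ • W₂ := by
    refine le_antisymm ?_ (Submodule.smul_le.2 fun a ha v hv => ⟨⟨a, ha⟩ ⊗ₜ ⟨v, hv⟩, rfl⟩)
    rintro _ ⟨t, rfl⟩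
    induction t using TensorProduct.induction_on with
    | zero => simp
    | add x y hx hy => rw [map_add]; exact add_mem hx hy
    | tmul a v => rw [hμ]; exact Submodule.smul_mem_smul a.2 v.2
  rw [← hr]
  refine isLineSubbundle_range' (P := W₁ ⊗[R] W₂) μ (h.mono ?_)
  rintro _ ⟨a, ha, v, hv, rfl⟩
  exact ⟨⟨a, ha⟩ ⊗ₜ ⟨v, hv⟩, rfl⟩

end Product

section IndObjects

variable {k : Type u} [Field k] (C : Curve k)

/-- The presheaf `𝓜_d`: the projective space of `k^d[X]`. -/
abbrev scalarStage (d : ℕ) : (Aff k)ᵒᵖ ⥤ Type u := projSpace (k := k) (C.poleSpace d)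

/-- The presheaf `𝓛_d`: the projective space of the space `k^d[X] ^ N` of global sections of the
bundle `𝒪(d D) ^ N` on `Xbar`. -/
abbrev lineStage (N d : ℕ) : (Aff k)ᵒᵖ ⥤ Type u :=
  projSpace (k := k) (Fin N → C.poleSpace d)

/-- The embeddings `𝓜_d → 𝓜_e` for `d ≤ e`. -/
def scalarTransition {d e : ℕ} (h : d ≤ e) : scalarStage C d ⟶ scalarStage C e :=
  projSpaceMap (Submodule.inclusion (C.poleSpace_mono h)) (Submodule.inclusion_injective _)

/-- The embeddings `𝓛_d → 𝓛_e` for `d ≤ e`. -/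
def lineTransition (N : ℕ) {d e : ℕ} (h : d ≤ e) : lineStage C N d ⟶ lineStage C N e :=
  projSpaceMap ((Submodule.inclusion (C.poleSpace_mono h)).compLeft (Fin N))
    ((Submodule.inclusion_injective (C.poleSpace_mono h)).comp_left)

variable (R : Type u) [CommRing R] [Algebra k R]

/-- Sections of `𝒪(d D)` depending on a parameter in `S = Spec R`, as functions on `S × X`. -/
def evScalar (d : ℕ) : R ⊗[k] C.poleSpace d →ₗ[R] R ⊗[k] C.coordRing :=
  (C.poleSpace d).subtype.baseChange R

/-- Sections of `𝒪(d D) ^ N` depending on a parameter in `S = Spec R`, as vectors of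
functions on `S × X`. -/
def evLine (N d : ℕ) : R ⊗[k] (Fin N → C.poleSpace d) →ₗ[R] (Fin N → R ⊗[k] C.coordRing) :=
  LinearMap.pi fun i => ((C.poleSpace d).subtype ∘ₗ LinearMap.proj i).baseChange R

lemma evScalar_retraction (d : ℕ) : ∃ ρ : R ⊗[k] C.coordRing →ₗ[R] R ⊗[k] C.poleSpace d,
    ρ ∘ₗ evScalar C R d = LinearMap.id :=
  exists_baseChange_retraction R _ (Submodule.subtype_injective _)

lemma evLine_retraction (N d : ℕ) :
    ∃ ρ : (Fin N → R ⊗[k] C.coordRing) →ₗ[R] R ⊗[k] (Fin N → C.poleSpace d),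
      ρ ∘ₗ evLine C R N d = LinearMap.id := by
  obtain ⟨r, hr⟩ := LinearMap.exists_leftInverse_of_injective (C.poleSpace d).subtype
    (Submodule.ker_subtype _)
  refine ⟨∑ i, (LinearMap.single k (fun _ => C.poleSpace d) i ∘ₗ r).baseChange R ∘ₗ
    LinearMap.proj i, ?_⟩
  refine LinearMap.ext fun x => ?_
  induction x using TensorProduct.induction_on with
  | zero => simp only [map_zero]
  | add x y hx hy => simp only [map_add, hx, hy]
  | tmul s v =>
    have hr' : ∀ a : C.poleSpace d, r a = a := fun a => LinearMap.congr_fun hr a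
    simp only [LinearMap.coe_comp, Function.comp_apply, LinearMap.sum_apply, LinearMap.proj_apply,
      evLine, LinearMap.pi_apply, LinearMap.baseChange_tmul, Submodule.subtype_apply, hr',
      LinearMap.id_apply, ← TensorProduct.tmul_sum]
    congr 1
    exact Finset.univ_sum_single v

lemma mem_range_evLine {N d : ℕ} {v : Fin N → R ⊗[k] C.coordRing} :
    v ∈ LinearMap.range (evLine C R N d) ↔ ∀ i, v i ∈ LinearMap.range (evScalar C R d) := by
  constructor
  · rintro ⟨x, rfl⟩ i
    refine ⟨(LinearMap.proj i).baseChange R x, ?_⟩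
    simp only [evLine, LinearMap.pi_apply, LinearMap.baseChange_comp]
    rfl
  · intro h
    choose x hx using h
    refine ⟨∑ i, (LinearMap.single k (fun _ => C.poleSpace d) i).baseChange R (x i), ?_⟩
    ext j
    rw [← hx j]
    simp only [map_sum, evLine, LinearMap.pi_apply, evScalar]
    rw [Finset.sum_eq_single j]
    · rw [← LinearMap.comp_apply, ← LinearMap.baseChange_comp]
      congr 2
      ext a
      simp
    · intro i _ hij
      rw [← LinearMap.comp_apply, ← LinearMap.baseChange_comp]
      have : ((C.poleSpace d).subtype ∘ₗ LinearMap.proj j) ∘ₗ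
          LinearMap.single k (fun _ => C.poleSpace d) i = 0 := by
        ext a
        simp [Pi.single_eq_of_ne hij.symm]
      rw [this, LinearMap.baseChange_zero, LinearMap.zero_apply]
    · simp

lemma range_evScalar_mono {d e : ℕ} (h : d ≤ e) :
    LinearMap.range (evScalar C R d) ≤ LinearMap.range (evScalar C R e) := by
  rintro _ ⟨x, rfl⟩
  refine ⟨(Submodule.inclusion (C.poleSpace_mono h)).baseChange R x, ?_⟩
  rw [evScalar, ← LinearMap.comp_apply, ← LinearMap.baseChange_comp]
  rfl

lemma mul_mem_range_evScalar {d e : ℕ} {x y : R ⊗[k] C.coordRing}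
    (hx : x ∈ LinearMap.range (evScalar C R d)) (hy : y ∈ LinearMap.range (evScalar C R e)) :
    x * y ∈ LinearMap.range (evScalar C R (d + e)) := by
  obtain ⟨x, rfl⟩ := hx
  obtain ⟨y, rfl⟩ := hy
  induction x using TensorProduct.induction_on with
  | zero => rw [map_zero, zero_mul]; exact zero_mem _
  | add x x' hx hx' => rw [map_add, add_mul]; exact add_mem hx hx'
  | tmul r a =>
    induction y using TensorProduct.induction_on with
    | zero => rw [map_zero, mul_zero]; exact zero_mem _
    | add y y' hy hy' => rw [map_add, mul_add]; exact add_mem hy hy'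
    | tmul s b =>
      exact ⟨(r * s) ⊗ₜ ⟨a * b, C.mul_mem_poleSpace a.2 b.2⟩,
        (Algebra.TensorProduct.tmul_mul_tmul r s (a : C.coordRing) (b : C.coordRing)).symm⟩

/-- The `S`-valued points of `𝓜_∞`, where `S = Spec R`: the union of the images of the (injective)
maps from the sets of `S`-valued points of the `𝓜_d` to the set of all
submodules of the ring of functions on `S × X`. -/
def IsScalarPoint (W : Submodule R (R ⊗[k] C.coordRing)) : Prop :=
  ∃ (d : ℕ) (W₀ : Submodule R (R ⊗[k] C.poleSpace d)),
    IsLineSubbundle W₀ ∧ W = W₀.map (evScalar C R d)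

/-- The `S`-valued points of `𝓛_∞`, where `S = Spec R`: the union of the images of the (injective)
maps from the sets of `S`-valued points of the `𝓛_d` to the set of all
`R`-submodules of the module of vectors of functions on `S × X`. -/
def IsLinePoint {N : ℕ} (W : Submodule R (Fin N → R ⊗[k] C.coordRing)) : Prop :=
  ∃ (d : ℕ) (W₀ : Submodule R (R ⊗[k] (Fin N → C.poleSpace d))),
    IsLineSubbundle W₀ ∧ W = W₀.map (evLine C R N d)

variable {R}

lemma isScalarPoint_iff {W : Submodule R (R ⊗[k] C.coordRing)} : IsScalarPoint C R W ↔
    IsLineSubbundle W ∧ ∃ d, W ≤ LinearMap.range (evScalar C R d) := by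
  rw [← exists_and_left]
  refine exists_congr fun d => ?_
  obtain ⟨ρ, hρ⟩ := evScalar_retraction C R d
  exact exists_map_iff _ ρ hρ W

lemma isLinePoint_iff {N : ℕ} {W : Submodule R (Fin N → R ⊗[k] C.coordRing)} :
    IsLinePoint C R W ↔
      IsLineSubbundle W ∧ ∃ d, W ≤ LinearMap.range (evLine C R N d) := by
  rw [← exists_and_left]
  refine exists_congr fun d => ?_
  obtain ⟨ρ, hρ⟩ := evLine_retraction C R N d
  exact exists_map_iff _ ρ hρ W

variable {R' : Type u} [CommRing R'] [Algebra k R']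

/-- The map on vectors of functions on `S × X` induced by `φ : R → R'`. -/
def bcPi (N : ℕ) (φ : R →ₐ[k] R') :
    (Fin N → R ⊗[k] C.coordRing) →ₛₗ[φ.toRingHom] (Fin N → R' ⊗[k] C.coordRing) where
  toFun v i := bcVec C.coordRing φ (v i)
  map_add' v w := by ext i; exact map_add (bcVec C.coordRing φ) _ _
  map_smul' c v := by ext i; exact map_smulₛₗ (bcVec C.coordRing φ) _ _

lemma bcPi_extends (N : ℕ) (φ : R →ₐ[k] R') (f : (Fin N → R ⊗[k] C.coordRing) →ₗ[R] R) :
    ∃ f' : (Fin N → R' ⊗[k] C.coordRing) →ₗ[R'] R',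
      ∀ x, f' (bcPi C N φ x) = φ.toRingHom (f x) := by
  choose g hg using fun i => bcVec_extends C.coordRing φ
    (f ∘ₗ LinearMap.single R (fun _ => R ⊗[k] C.coordRing) i)
  refine ⟨∑ i, g i ∘ₗ LinearMap.proj i, fun x => ?_⟩
  conv_rhs => rw [← Finset.univ_sum_single x, map_sum, map_sum]
  rw [LinearMap.sum_apply]
  exact Finset.sum_congr rfl fun i _ => hg i (x i)

lemma bcPi_evLine {N d : ℕ} (φ : R →ₐ[k] R') (x : R ⊗[k] (Fin N → C.poleSpace d)) :
    bcPi C N φ (evLine C R N d x) = evLine C R' N d (bcVec _ φ x) := by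
  ext i
  exact bcVec_baseChange _ φ x

lemma IsScalarPoint.bc {W : Submodule R (R ⊗[k] C.coordRing)} (h : IsScalarPoint C R W)
    (φ : R →ₐ[k] R') : IsScalarPoint C R'
      (Submodule.span R' (bcVec C.coordRing φ '' (W : Set (R ⊗[k] C.coordRing)))) := by
  rw [isScalarPoint_iff] at h ⊢
  refine ⟨h.1.span_image _ _ (bcVec_extends _ φ), ?_⟩
  obtain ⟨d, hd⟩ := h.2
  refine ⟨d, Submodule.span_le.2 ?_⟩
  rintro _ ⟨w, hw, rfl⟩
  obtain ⟨x, rfl⟩ := hd hw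
  exact ⟨bcVec _ φ x, (bcVec_baseChange _ φ x).symm⟩

lemma IsLinePoint.bc {N : ℕ} {W : Submodule R (Fin N → R ⊗[k] C.coordRing)}
    (h : IsLinePoint C R W) (φ : R →ₐ[k] R') : IsLinePoint C R'
      (Submodule.span R' (bcPi C N φ '' (W : Set (Fin N → R ⊗[k] C.coordRing)))) := by
  rw [isLinePoint_iff] at h ⊢
  refine ⟨h.1.span_image _ _ (bcPi_extends C N φ), ?_⟩
  obtain ⟨d, hd⟩ := h.2
  refine ⟨d, Submodule.span_le.2 ?_⟩
  rintro _ ⟨w, hw, rfl⟩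
  obtain ⟨x, rfl⟩ := hd hw
  exact ⟨bcVec _ φ x, (bcPi_evLine C φ x).symm⟩

end IndObjects

section Monoid

variable {k : Type u} [Field k] [IsAlgClosed k] (C : Curve k)
  {R : Type u} [CommRing R] [Algebra k R] [Algebra.FiniteType k R]

lemma isScalarPoint_one : IsScalarPoint C R 1 := by
  rw [isScalarPoint_iff, Submodule.one_eq_range]
  refine ⟨isLineSubbundle_range' _ ((isUnimodular_iff (k := k) _).2 fun χ => ⟨1, ⟨1, ?_⟩, ?_⟩),
    0, ?_⟩
  · exact map_one (algebraMap R (R ⊗[k] C.coordRing))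
  · rw [fibre_ne_zero_iff, map_one]
    exact one_ne_zero
  · rintro _ ⟨r, rfl⟩
    exact ⟨r ⊗ₜ ⟨1, C.one_mem_poleSpace⟩, rfl⟩

lemma IsScalarPoint.mul {W₁ W₂ : Submodule R (R ⊗[k] C.coordRing)} (h₁ : IsScalarPoint C R W₁)
    (h₂ : IsScalarPoint C R W₂) : IsScalarPoint C R (W₁ * W₂) := by
  rw [isScalarPoint_iff] at h₁ h₂ ⊢
  obtain ⟨h₁, d, hd⟩ := h₁
  obtain ⟨h₂, e, he⟩ := h₂
  refine ⟨h₁.smul h₂ ((isUnimodular_iff (k := k) _).2 fun χ => ?_), d + e,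
    Submodule.mul_le.2 fun x hx y hy => mul_mem_range_evScalar C R (hd hx) (he hy)⟩
  obtain ⟨x, hx, hx'⟩ := (isUnimodular_iff (k := k) _).1 h₁.isUnimodular χ
  obtain ⟨y, hy, hy'⟩ := (isUnimodular_iff (k := k) _).1 h₂.isUnimodular χ
  refine ⟨x * y, ⟨x, hx, y, hy, rfl⟩, ?_⟩
  rw [fibre_ne_zero_iff] at hx' hy' ⊢
  rw [map_mul]
  exact mul_ne_zero hx' hy'

lemma IsScalarPoint.smul {N : ℕ} {W₁ : Submodule R (R ⊗[k] C.coordRing)}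
    {W₂ : Submodule R (Fin N → R ⊗[k] C.coordRing)} (h₁ : IsScalarPoint C R W₁)
    (h₂ : IsLinePoint C R W₂) : IsLinePoint C R (W₁ • W₂) := by
  rw [isScalarPoint_iff] at h₁
  rw [isLinePoint_iff] at h₂ ⊢
  obtain ⟨h₁, d, hd⟩ := h₁
  obtain ⟨h₂, e, he⟩ := h₂
  refine ⟨h₁.smul h₂ ((isUnimodular_iff (k := k) _).2 fun χ => ?_), d + e,
    Submodule.smul_le.2 fun x hx y hy => (mem_range_evLine C R).2 fun i =>
      mul_mem_range_evScalar C R (hd hx) ((mem_range_evLine C R).1 (he hy) i)⟩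
  obtain ⟨x, hx, hx'⟩ := (isUnimodular_iff (k := k) _).1 h₁.isUnimodular χ
  obtain ⟨y, hy, hy'⟩ := (isUnimodular_iff (k := k) _).1 h₂.isUnimodular χ
  refine ⟨x • y, ⟨x, hx, y, hy, rfl⟩, ?_⟩
  rw [fibre_ne_zero_iff] at hx'
  rw [fibre_ne_zero_iff_pi] at hy' ⊢
  obtain ⟨i, hi⟩ := hy'
  refine ⟨i, ?_⟩
  rw [Pi.smul_apply, smul_eq_mul, map_mul]
  exact mul_ne_zero hx' hi

/-- The monoid of `S`-valued points of `𝓜_∞`, where `S = Spec R`; the product of two line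
sub-bundles is generated by the products of their sections. -/
def scalarMonoid (R : Type u) [CommRing R] [Algebra k R] [Algebra.FiniteType k R] :
    Submonoid (Submodule R (R ⊗[k] C.coordRing)) where
  carrier := {W | IsScalarPoint C R W}
  one_mem' := isScalarPoint_one C
  mul_mem' h₁ h₂ := h₁.mul C h₂

/-- The presheaf of commutative monoids `𝓜_∞`. -/
def scalars : (Aff k)ᵒᵖ ⥤ Type u where
  obj S := scalarMonoid C (fn S)
  map {S T} f := ↾fun W => ⟨Submodule.span (fn T) (bcVec C.coordRing (pb f) ''
    (W.1 : Set (fn S ⊗[k] C.coordRing))), IsScalarPoint.bc C W.2 (pb f)⟩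
  map_id S := by
    refine ConcreteCategory.hom_ext _ _ fun W => Subtype.ext ?_
    change Submodule.span (fn S) (bcVec C.coordRing (AlgHom.id k (fn S)) '' _) = W.1
    simp only [bcVec_id, Set.image_id', Submodule.span_eq]
  map_comp {S T T'} f g := by
    refine ConcreteCategory.hom_ext _ _ fun W => Subtype.ext ?_
    change Submodule.span (fn T') (bcVec C.coordRing ((pb g).comp (pb f)) '' _) =
      Submodule.span (fn T') (bcVec C.coordRing (pb g) '' (Submodule.span (fn T)
        (bcVec C.coordRing (pb f) '' (W.1 : Set (fn S ⊗[k] C.coordRing))) :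
          Set (fn T ⊗[k] C.coordRing)))
    rw [span_image_span, Set.image_image]
    simp only [bcVec_comp]

instance (S : (Aff k)ᵒᵖ) : CommMonoid ((scalars C).obj S) :=
  inferInstanceAs (CommMonoid (scalarMonoid C (fn S)))

/-- The presheaf `𝓛_∞`. -/
def lines (N : ℕ) : (Aff k)ᵒᵖ ⥤ Type u where
  obj S := {W : Submodule (fn S) (Fin N → fn S ⊗[k] C.coordRing) // IsLinePoint C (fn S) W}
  map {S T} f := ↾fun W => ⟨Submodule.span (fn T) (bcPi C N (pb f) ''
    (W.1 : Set (Fin N → fn S ⊗[k] C.coordRing))), IsLinePoint.bc C W.2 (pb f)⟩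
  map_id S := by
    refine ConcreteCategory.hom_ext _ _ fun W => Subtype.ext ?_
    change Submodule.span (fn S) (bcPi C N (AlgHom.id k (fn S)) '' _) = W.1
    have : ∀ v, bcPi C N (AlgHom.id k (fn S)) v = v := fun v =>
      funext fun i => bcVec_id _ (v i)
    simp only [this, Set.image_id', Submodule.span_eq]
  map_comp {S T T'} f g := by
    refine ConcreteCategory.hom_ext _ _ fun W => Subtype.ext ?_
    change Submodule.span (fn T') (bcPi C N ((pb g).comp (pb f)) '' _) =
      Submodule.span (fn T') (bcPi C N (pb g) '' (Submodule.span (fn T)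
        (bcPi C N (pb f) '' (W.1 : Set (Fin N → fn S ⊗[k] C.coordRing))) :
          Set (Fin N → fn T ⊗[k] C.coordRing)))
    have : ∀ v, bcPi C N ((pb g).comp (pb f)) v = bcPi C N (pb g) (bcPi C N (pb f) v) :=
      fun v => funext fun i => bcVec_comp _ _ _ (v i)
    rw [span_image_span, Set.image_image]
    simp only [this]

/-- The action of `𝓜_∞` on `𝓛_∞`; the product of two line sub-bundles is
generated by the products of their sections. -/
instance (N : ℕ) (S : (Aff k)ᵒᵖ) : MulAction ((scalars C).obj S) ((lines C N).obj S) where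
  smul m f := ⟨m.1 • f.1, IsScalarPoint.smul C m.2 f.2⟩
  one_smul f := Subtype.ext (Submodule.one_smul (N := f.1))
  mul_smul m n f := Subtype.ext (Submodule.smul_assoc m.1 n.1 f.1)

lemma coe_smul {N : ℕ} {S : (Aff k)ᵒᵖ} (m : (scalars C).obj S) (f : (lines C N).obj S) :
    (m • f).1 = m.1 • f.1 := rfl

end Monoid

section Naturality

variable {k : Type u} [Field k] [IsAlgClosed k] (C : Curve k) {S T : (Aff k)ᵒᵖ} (f : S ⟶ T)

lemma scalars_map_one : (scalars C).map f (1 : (scalars C).obj S) = 1 := by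
  refine Subtype.ext ?_
  change Submodule.span (fn T) (bcVec C.coordRing (pb f) ''
    ((1 : Submodule (fn S) (fn S ⊗[k] C.coordRing)) : Set _)) = 1
  rw [Submodule.one_eq_span, span_image_span, Set.image_singleton, Submodule.one_eq_span]
  congr 2
  exact map_one (bcRing C.coordRing (pb f))

lemma span_image_smul {R R' B B' Q Q' : Type u} [CommRing R] [CommRing R'] [CommRing B]
    [CommRing B'] [Algebra R B] [Algebra R' B'] [AddCommGroup Q] [AddCommGroup Q']
    [Module R Q] [Module B Q] [IsScalarTower R B Q] [Module R' Q'] [Module B' Q']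
    [IsScalarTower R' B' Q'] {σ : R →+* R'} (g : B →ₛₗ[σ] B') (h : Q →ₛₗ[σ] Q')
    (hgh : ∀ b q, h (b • q) = g b • h q) (W₁ : Submodule R B) (W₂ : Submodule R Q) :
    Submodule.span R' (h '' ((W₁ • W₂ : Submodule R Q) : Set Q)) =
      Submodule.span R' (g '' (W₁ : Set B)) • Submodule.span R' (h '' (W₂ : Set Q)) := by
  refine le_antisymm (Submodule.span_le.2 ?_) (Submodule.smul_le.2 ?_)
  · rintro _ ⟨x, hx, rfl⟩
    refine Submodule.smul_induction_on hx (fun b hb q hq => ?_) fun x y hx hy => ?_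
    · rw [hgh]
      exact Submodule.smul_mem_smul (Submodule.subset_span ⟨b, hb, rfl⟩)
        (Submodule.subset_span ⟨q, hq, rfl⟩)
    · rw [map_add]
      exact add_mem hx hy
  · intro b hb q hq
    induction hb using Submodule.span_induction with
    | zero => rw [zero_smul]; exact zero_mem _
    | add b b' _ _ hb hb' => rw [add_smul]; exact add_mem hb hb'
    | smul c b _ hb => rw [smul_assoc]; exact Submodule.smul_mem _ _ hb
    | mem b hb =>
      obtain ⟨b, hb, rfl⟩ := hb
      induction hq using Submodule.span_induction with
      | zero => rw [smul_zero]; exact zero_mem _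
      | add q q' _ _ hq hq' => rw [smul_add]; exact add_mem hq hq'
      | smul c q _ hq => rw [smul_algebra_smul_comm]; exact Submodule.smul_mem _ _ hq
      | mem q hq =>
        obtain ⟨q, hq, rfl⟩ := hq
        rw [← hgh]
        exact Submodule.subset_span ⟨_, Submodule.smul_mem_smul hb hq, rfl⟩

lemma scalars_map_mul (m n : (scalars C).obj S) :
    (scalars C).map f (m * n) = (scalars C).map f m * (scalars C).map f n :=
  Subtype.ext (span_image_smul (bcVec C.coordRing (pb f)) (bcVec C.coordRing (pb f))
    (fun b q => map_mul (bcRing C.coordRing (pb f)) b q) m.1 n.1)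

lemma lines_map_smul {N : ℕ} (m : (scalars C).obj S) (l : (lines C N).obj S) :
    (lines C N).map f (m • l) = (scalars C).map f m • (lines C N).map f l :=
  Subtype.ext (span_image_smul (bcVec C.coordRing (pb f)) (bcPi C N (pb f))
    (fun b q => funext fun i => map_mul (bcRing C.coordRing (pb f)) b (q i)) m.1 l.1)

end Naturality

section StageMaps

variable {k : Type u} [Field k] (C : Curve k)

/-- The map `𝓜_d → 𝓜_∞`. -/
def scalarIncl [IsAlgClosed k] (d : ℕ) : scalarStage C d ⟶ scalars C where
  app S := ↾fun W => ⟨W.1.map (evScalar C (fn S) d), d, W.1, W.2, rfl⟩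
  naturality S T f := by
    refine ConcreteCategory.hom_ext _ _ fun W => Subtype.ext ?_
    change Submodule.map (evScalar C (fn T) d) (Submodule.span (fn T) _) =
      Submodule.span (fn T) (bcVec C.coordRing (pb f) ''
        (Submodule.map (evScalar C (fn S) d) W.1 : Set _))
    rw [Submodule.map_span, Submodule.map_coe, Set.image_image, Set.image_image]
    simp only [evScalar, bcVec_baseChange]

/-- The map `𝓛_d → 𝓛_∞`. -/
def lineIncl [IsAlgClosed k] (N d : ℕ) : lineStage C N d ⟶ lines C N where
  app S := ↾fun W => ⟨W.1.map (evLine C (fn S) N d), d, W.1, W.2, rfl⟩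
  naturality S T f := by
    refine ConcreteCategory.hom_ext _ _ fun W => Subtype.ext ?_
    change Submodule.map (evLine C (fn T) N d) (Submodule.span (fn T) _) =
      Submodule.span (fn T) (bcPi C N (pb f) ''
        (Submodule.map (evLine C (fn S) N d) W.1 : Set _))
    rw [Submodule.map_span, Submodule.map_coe, Set.image_image, Set.image_image]
    simp only [bcPi_evLine]

lemma scalarTransition_incl [IsAlgClosed k] {d e : ℕ} (h : d ≤ e) :
    scalarTransition C h ≫ scalarIncl C e = scalarIncl C d := by
  ext S : 2
  refine ConcreteCategory.hom_ext _ _ fun W => Subtype.ext ?_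
  change Submodule.map (evScalar C (fn S) e) (Submodule.map _ W.1) = _
  rw [← Submodule.map_comp, evScalar, ← LinearMap.baseChange_comp]
  rfl

lemma lineTransition_incl [IsAlgClosed k] (N : ℕ) {d e : ℕ} (h : d ≤ e) :
    lineTransition C N h ≫ lineIncl C N e = lineIncl C N d := by
  ext S : 2
  refine ConcreteCategory.hom_ext _ _ fun W => Subtype.ext ?_
  change Submodule.map (evLine C (fn S) N e) (Submodule.map _ W.1) =
    Submodule.map (evLine C (fn S) N d) W.1
  rw [← Submodule.map_comp]
  congr 1
  refine LinearMap.ext fun x => funext fun i => ?_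
  simp only [evLine, LinearMap.comp_apply, LinearMap.pi_apply]
  rw [← LinearMap.comp_apply, ← LinearMap.baseChange_comp]
  rfl

lemma projSpaceMap_id {V : Type u} [AddCommGroup V] [Module k V] (j : V →ₗ[k] V)
    (hj : Function.Injective j) (h : j = LinearMap.id) : projSpaceMap j hj = 𝟙 _ := by
  subst h
  ext S : 2
  refine ConcreteCategory.hom_ext _ _ fun W => Subtype.ext ?_
  change Submodule.map (LinearMap.baseChange (fn S) LinearMap.id) W.1 = W.1
  rw [LinearMap.baseChange_id, Submodule.map_id]

lemma projSpaceMap_comp {V V' V'' : Type u} [AddCommGroup V] [Module k V] [AddCommGroup V']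
    [Module k V'] [AddCommGroup V''] [Module k V''] (j : V →ₗ[k] V')
    (hj : Function.Injective j) (j' : V' →ₗ[k] V'') (hj' : Function.Injective j')
    (j'' : V →ₗ[k] V'') (hj'' : Function.Injective j'') (h : j'' = j' ∘ₗ j) :
    projSpaceMap j'' hj'' = projSpaceMap j hj ≫ projSpaceMap j' hj' := by
  subst h
  ext S : 2
  refine ConcreteCategory.hom_ext _ _ fun W => Subtype.ext ?_
  change Submodule.map (LinearMap.baseChange (fn S) (j' ∘ₗ j)) W.1 =
    Submodule.map _ (Submodule.map _ W.1)
  rw [LinearMap.baseChange_comp, Submodule.map_comp]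

end StageMaps

section GenericLineMap

variable {k : Type u} [Field k] [IsAlgClosed k]

/-- Like `coordMap`, as a semilinear map over a smaller ring. -/
def coordMapOver (N : ℕ) (R : Type*) {B B' : Type*} [CommRing R] [CommRing B] [CommRing B']
    [Algebra R B] (σ : B →+* B') : (Fin N → B) →ₛₗ[σ.comp (algebraMap R B)] (Fin N → B') where
  toFun v i := σ (v i)
  map_add' v w := by ext; simp
  map_smul' c v := by ext; simp [Algebra.smul_def]

variable {R A : Type u} [CommRing R] [Algebra k R] [CommRing A] [Algebra k A]

lemma isDomainOpen_of_isUnimodular [IsDomain A] [Algebra.FiniteType k R] {N : ℕ}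
    {W : Submodule R (Fin N → R ⊗[k] A)} (hW : IsUnimodular R (W : Set (Fin N → R ⊗[k] A)))
    (U : Opens (PrimeSpectrum (R ⊗[k] A)))
    (hU : ∀ q : PrimeSpectrum (R ⊗[k] A), (∃ w ∈ W, ∃ i, w i ∉ q.asIdeal) → q ∈ U) :
    IsDomainOpen U := by
  by_contra hc
  rw [IsDomainOpen, not_forall] at hc
  obtain ⟨p, hp⟩ := hc
  have ho : IsOpen (PrimeSpectrum.comap (algebraMap R (R ⊗[k] A)) '' (U : Set _)) :=
    PrimeSpectrum.isOpenMap_comap_algebraMap_tensorProduct_of_field _ U.isOpen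
  obtain ⟨m, hm, hle⟩ := Ideal.exists_le_maximal p.asIdeal p.2.ne_top
  obtain ⟨χ, rfl⟩ := exists_point (k := k) m hm
  obtain ⟨w, hw, hw'⟩ := (isUnimodular_iff (k := k) _).1 hW χ
  obtain ⟨i, hi⟩ := (fibre_ne_zero_iff_pi χ w).1 hw'
  let q : PrimeSpectrum (R ⊗[k] A) := ⟨RingHom.ker (fibre A χ), RingHom.ker_isPrime _⟩
  have hq : q ∈ U := hU q ⟨w, hw, i, hi⟩
  have hmem : PrimeSpectrum.comap (algebraMap R (R ⊗[k] A)) q ∈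
      PrimeSpectrum.comap (algebraMap R (R ⊗[k] A)) '' (U : Set _) := ⟨q, hq, rfl⟩
  have hspec : p ⤳ PrimeSpectrum.comap (algebraMap R (R ⊗[k] A)) q := by
    rw [← PrimeSpectrum.le_iff_specializes]
    intro r hr
    have hr' : χ r = 0 := hle hr
    change fibre A χ (r ⊗ₜ 1) = 0
    rw [fibre_tmul, hr', zero_smul]
  obtain ⟨q', hq', hq''⟩ := hspec.mem_open ho hmem
  exact hp ⟨q', hq', hq''⟩

/-- The generic line given by a line sub-bundle `W` of the `R`-module of vectors of functions on
`S × X`, where `S = Spec R`: its domain is the locus where the pull back of `W` to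
`S × X` maps injectively to the fibres of the trivial bundle (that is, where some
section of `W` does not vanish), and there it is the image of this pull back. -/
def lineOf [IsDomain A] [Algebra.FiniteType k R] {N : ℕ} (W : Submodule R (Fin N → R ⊗[k] A))
    (hW : IsLineSubbundle W) : LineOnDomain k N R A where
  U := ⟨{q | ∃ w ∈ W, ∃ i, w i ∉ q.asIdeal}, by
    have : {q : PrimeSpectrum (R ⊗[k] A) | ∃ w ∈ W, ∃ i, w i ∉ q.asIdeal} =
        ⋃ w ∈ W, ⋃ i, (PrimeSpectrum.basicOpen (w i) : Set (PrimeSpectrum (R ⊗[k] A))) := by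
      ext q
      simp
    rw [this]
    exact isOpen_biUnion fun w _ => isOpen_iUnion fun i => (PrimeSpectrum.basicOpen (w i)).isOpen⟩
  isDomainOpen := isDomainOpen_of_isUnimodular hW.isUnimodular _ fun _ h => h
  line :=
    { stalk := fun q _ => Submodule.span (Localization.AtPrime q.asIdeal)
        (coordMap N (algebraMap (R ⊗[k] A) (Localization.AtPrime q.asIdeal)) ''
          (W : Set (Fin N → R ⊗[k] A)))
      locally_eq := by
        rintro q ⟨w, hw, i, hi⟩
        refine ⟨w i, hi, fun q' hq' => ⟨w, hw, i, hq'⟩, Submodule.span (R ⊗[k] A) W, ?_, ?_⟩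
        · rw [extend, span_image_span]
          refine isLineSubbundle_span _
            (coordMapOver N R (algebraMap (R ⊗[k] A) (Localization.Away (w i)))) hW.invertible ?_
          refine Ideal.eq_top_of_isUnit_mem _ (Ideal.subset_span ⟨LinearMap.proj i, _,
            ⟨w, hw, rfl⟩, rfl⟩) ?_
          exact IsLocalization.Away.algebraMap_isUnit (w i)
        · intro q' _ _
          rw [extend, span_image_span] }

/-- The map `F_∞ : 𝓛_∞ → 𝓛`. -/
def toGeneric (C : Curve k) (N : ℕ) : lines C N ⟶ genericLines C N where
  app S := ↾fun W => Quot.mk _ (lineOf W.1 ((isLinePoint_iff C).1 W.2).1)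
  naturality S T f := by
    refine ConcreteCategory.hom_ext _ _ fun W => ?_
    refine Quot.sound ⟨?_, ?_⟩
    · rintro q ⟨w, hw, i, hi⟩
      exact ⟨bcPi C N (pb f) w, Submodule.subset_span ⟨w, hw, rfl⟩, i, hi⟩
    · intro q hq
      let B' := fn T ⊗[k] C.coordRing
      let σ := (bcRing C.coordRing (pb f)).toRingHom
      change extend (Localization.localRingHom (PrimeSpectrum.comap σ q).asIdeal q.asIdeal σ rfl)
        (Submodule.span _ _) = Submodule.span (Localization.AtPrime q.asIdeal)
          (coordMapOver N (fn T) (algebraMap B' (Localization.AtPrime q.asIdeal)) ''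
            (Submodule.span (fn T) (bcPi C N (pb f) ''
              (W.1 : Set (Fin N → fn S ⊗[k] C.coordRing))) : Set (Fin N → B')))
      rw [extend, span_image_span, span_image_span, Set.image_image, Set.image_image]
      congr 1
      refine Set.image_congr fun v _ => funext fun i => ?_
      exact Localization.localRingHom_to_map (PrimeSpectrum.comap σ q).asIdeal q.asIdeal σ rfl
        (v i)

/-- The maps `F_d : 𝓛_d → 𝓛`. -/
def stageToGeneric (C : Curve k) (N d : ℕ) : lineStage C N d ⟶ genericLines C N :=
  lineIncl C N d ≫ toGeneric C N

end GenericLineMap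

section SubPresheaf

variable {k : Type u} [Field k] [IsAlgClosed k] {C : Curve k} {N : ℕ}

/-- `𝓑_d`, the pull back of the sub-presheaf `𝓑` of `𝓛` along `F_d`. -/
def subStage (𝓑 : Subfunctor (genericLines C N)) (d : ℕ) : Subfunctor (lineStage C N d) :=
  𝓑.preimage (stageToGeneric C N d)

/-- `𝓑_∞`, the pull back of the sub-presheaf `𝓑` of `𝓛` along `F_∞`. -/
def subLines (𝓑 : Subfunctor (genericLines C N)) : Subfunctor (lines C N) :=
  𝓑.preimage (toGeneric C N)

/-- The map `𝓑_d → 𝓑`. -/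
def subStageToGeneric (𝓑 : Subfunctor (genericLines C N)) (d : ℕ) :
    (subStage 𝓑 d).toFunctor ⟶ 𝓑.toFunctor :=
  𝓑.fromPreimage (stageToGeneric C N d)

/-- The map `𝓑_∞ → 𝓑`. -/
def subToGeneric (𝓑 : Subfunctor (genericLines C N)) :
    (subLines 𝓑).toFunctor ⟶ 𝓑.toFunctor :=
  𝓑.fromPreimage (toGeneric C N)

lemma lineTransition_toGeneric {d e : ℕ} (h : d ≤ e) :
    lineTransition C N h ≫ stageToGeneric C N e = stageToGeneric C N d := by
  rw [stageToGeneric, ← Category.assoc, lineTransition_incl]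
  rfl

lemma lineTransition_refl (d : ℕ) (h : d ≤ d) : lineTransition C N h = 𝟙 _ :=
  projSpaceMap_id _ _ rfl

lemma lineTransition_comp {d e f : ℕ} (h : d ≤ e) (h' : e ≤ f) (h'' : d ≤ f) :
    lineTransition C N h'' = lineTransition C N h ≫ lineTransition C N h' :=
  projSpaceMap_comp _ _ _ _ _ _ rfl

/-- The maps `𝓑_d → 𝓑_e` for `d ≤ e`. -/
def subTransition (𝓑 : Subfunctor (genericLines C N)) {d e : ℕ} (h : d ≤ e) :
    (subStage 𝓑 d).toFunctor ⟶ (subStage 𝓑 e).toFunctor :=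
  Subfunctor.lift ((subStage 𝓑 d).ι ≫ lineTransition C N h) (by
    rw [Subfunctor.range_comp, Subfunctor.range_ι, Subfunctor.image_le_iff, subStage, subStage,
      ← Subfunctor.preimage_comp, lineTransition_toGeneric])

/-- The maps `𝓑_d → 𝓑_∞`. -/
def subIncl (𝓑 : Subfunctor (genericLines C N)) (d : ℕ) :
    (subStage 𝓑 d).toFunctor ⟶ (subLines 𝓑).toFunctor :=
  Subfunctor.lift ((subStage 𝓑 d).ι ≫ lineIncl C N d) (by
    rw [Subfunctor.range_comp, Subfunctor.range_ι, Subfunctor.image_le_iff, subStage,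
      subLines, ← Subfunctor.preimage_comp]
    rfl)

lemma subTransition_ι (𝓑 : Subfunctor (genericLines C N)) {d e : ℕ} (h : d ≤ e) :
    subTransition 𝓑 h ≫ (subStage 𝓑 e).ι = (subStage 𝓑 d).ι ≫ lineTransition C N h :=
  Subfunctor.lift_ι _ _

lemma subIncl_ι (𝓑 : Subfunctor (genericLines C N)) (d : ℕ) :
    subIncl 𝓑 d ≫ (subLines 𝓑).ι = (subStage 𝓑 d).ι ≫ lineIncl C N d :=
  Subfunctor.lift_ι _ _

lemma subTransition_incl (𝓑 : Subfunctor (genericLines C N)) {d e : ℕ} (h : d ≤ e) :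
    subTransition 𝓑 h ≫ subIncl 𝓑 e = subIncl 𝓑 d := by
  rw [← cancel_mono (subLines 𝓑).ι, Category.assoc, subIncl_ι, ← Category.assoc,
    subTransition_ι, Category.assoc, lineTransition_incl, subIncl_ι]

/-- The sequence of presheaves `𝓑_0 → 𝓑_1 → 𝓑_2 → ⋯`. -/
def subDiagram (𝓑 : Subfunctor (genericLines C N)) : ℕ ⥤ (Aff k)ᵒᵖ ⥤ Type u where
  obj d := (subStage 𝓑 d).toFunctor
  map h := subTransition 𝓑 (leOfHom h)
  map_id d := by
    rw [← cancel_mono (subStage 𝓑 d).ι, subTransition_ι, lineTransition_refl, Category.comp_id,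
      Category.id_comp]
  map_comp {_ _ f} h h' := by
    rw [← cancel_mono (subStage 𝓑 f).ι, subTransition_ι, Category.assoc, subTransition_ι,
      ← Category.assoc, subTransition_ι, Category.assoc,
      lineTransition_comp (leOfHom h) (leOfHom h')]

/-- The cocone formed by the maps `𝓑_d → 𝓑_∞`. -/
def subCocone (𝓑 : Subfunctor (genericLines C N)) : Cocone (subDiagram 𝓑) where
  pt := (subLines 𝓑).toFunctor
  ι :=
    { app := fun d => subIncl 𝓑 d
      naturality := fun _ _ h =>
        (subTransition_incl 𝓑 (leOfHom h)).trans (Category.comp_id _).symm }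

/-- The relation `f ∼ m f` on a sub-presheaf of `𝓛_∞`. -/
def OrbitRel (𝓖 : Subfunctor (lines C N)) (S : (Aff k)ᵒᵖ) (f g : 𝓖.obj S) : Prop :=
  ∃ m : (scalars C).obj S, m • f.1 = g.1

/-- The pull back of sections of a sub-presheaf of `𝓛_∞`. -/
def subMap (𝓖 : Subfunctor (lines C N)) {S T : (Aff k)ᵒᵖ} (φ : S ⟶ T) (f : 𝓖.obj S) : 𝓖.obj T :=
  ⟨(lines C N).map φ f.1, 𝓖.map φ f.2⟩

lemma OrbitRel.map {𝓖 : Subfunctor (lines C N)} {S T : (Aff k)ᵒᵖ} (φ : S ⟶ T) {f g : 𝓖.obj S}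
    (h : OrbitRel 𝓖 S f g) : OrbitRel 𝓖 T (subMap 𝓖 φ f) (subMap 𝓖 φ g) := by
  obtain ⟨m, hm⟩ := h
  exact ⟨(scalars C).map φ m,
    (lines_map_smul C φ m f.1).symm.trans (congrArg ((lines C N).map φ) hm)⟩

lemma subMap_id (𝓖 : Subfunctor (lines C N)) {S : (Aff k)ᵒᵖ} (f : 𝓖.obj S) :
    subMap 𝓖 (𝟙 S) f = f :=
  SetCoe.ext (FunctorToTypes.map_id_apply (lines C N) f.1)

lemma subMap_comp (𝓖 : Subfunctor (lines C N)) {S T T' : (Aff k)ᵒᵖ} (φ : S ⟶ T) (ψ : T ⟶ T')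
    (f : 𝓖.obj S) : subMap 𝓖 (φ ≫ ψ) f = subMap 𝓖 ψ (subMap 𝓖 φ f) :=
  SetCoe.ext (FunctorToTypes.map_comp_apply (lines C N) φ ψ f.1)

/-- The quotient presheaf by the action of `𝓜_∞`: the quotient of a sub-presheaf of `𝓛_∞` by the
equivalence relation generated by `f ∼ m f`. -/
def orbits (𝓖 : Subfunctor (lines C N)) : (Aff k)ᵒᵖ ⥤ Type u where
  obj S := Quot (OrbitRel 𝓖 S)
  map {S T} f := ↾(Quot.map (ra := OrbitRel 𝓖 S) (rb := OrbitRel 𝓖 T) (subMap 𝓖 f)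
    fun _ _ h => OrbitRel.map f h)
  map_id S := by
    refine ConcreteCategory.hom_ext _ _ fun x => ?_
    obtain ⟨x, rfl⟩ := Quot.exists_rep x
    exact congrArg (Quot.mk _) (subMap_id 𝓖 x)
  map_comp f g := by
    refine ConcreteCategory.hom_ext _ _ fun x => ?_
    obtain ⟨x, rfl⟩ := Quot.exists_rep x
    exact congrArg (Quot.mk _) (subMap_comp 𝓖 f g x)

/-- The projection to the quotient by the action of `𝓜_∞`. -/
def toOrbits (𝓖 : Subfunctor (lines C N)) : 𝓖.toFunctor ⟶ orbits 𝓖 where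
  app S := ↾(Quot.mk (OrbitRel 𝓖 S))
  naturality _ _ _ := rfl

end SubPresheaf

end GenericLines

end

open GenericLines

noncomputable section

/-! Since `k` is algebraically closed and `S` is of finite type, most questions over `S` can be
tested at `k`-points `χ`. The decisive point of `S × X` over `χ` is the generic point `fibrePoint`
of the fibre: an open subset is a domain exactly when it contains all of these (`isDomainOpen_iff`).
So a generic line has a well-defined stalk at each of them, and everything is a computation with
vectors of functions near these stalks.

Local lifting. Near such a point a generic line is spanned by a vector `w` of functions, wherever
some function `h` does not vanish (`LineOnDomain.exists_generator`). A linear form takes on `h` a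
value nonzero at `χ`; after inverting this value, `h` vanishes identically on no fibre, so `w` spans
a line sub-bundle. The divisor at infinity is a finite set, hence poles are bounded
(`Curve.exists_mem_poleSpace`) and `w` lives at a finite stage.

Fibres of `F_∞`. Multiplying by scalars does not change the span where one of the scalars is
invertible (`genericLineOf_smul`). Conversely, if two points give the same generic line, their local
generators are proportional in the stalk; clearing denominators gives `m • w = m' • w'` with `m`,
`m'` nonzero on the fibre (`exists_smul_eq_smul`). After shrinking `S` these span points of `𝓜_∞`.

Freeness. Cancelling a vector that is nonzero on the fibre is legitimate near `χ`, by Nakayama's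
lemma applied to an ideal of coefficients (`exists_smul_eq_zero`, `le_of_smul_le_smul`).

The rest is formal. Invariance of `F_∞` makes every preimage `𝓑_∞` stable under the action. The
colimit is a union of subsets over each `S`. The map from the quotient presheaf to `𝓑` is locally
surjective and locally injective, hence an isomorphism after sheafification. -/

namespace GenericLines

/-! ### Finiteness of the boundary and boundedness of poles. -/

section Geometry

/-- A proper closed subset of an irreducible noetherian space of dimension at most one is
finite. -/
lemma finite_of_isClosed {T : Type*} [TopologicalSpace T] [NoetherianSpace T]
    [IrreducibleSpace T] [T0Space T] (hT : topologicalKrullDim T ≤ 1) {Z : Set T}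
    (hZ : IsClosed Z) (hne : Z ≠ Set.univ) : Z.Finite := by
  obtain ⟨S, hS, hc, hi, rfl⟩ := NoetherianSpace.exists_finite_set_isClosed_irreducible hZ
  refine hS.sUnion fun t ht => Set.Subsingleton.finite ?_
  have hT' := Order.krullDim_le_one_iff.1 hT
  let t' : IrreducibleCloseds T := ⟨t, hi t ht, hc t ht⟩
  -- In dimension at most one an irreducible closed set is minimal or maximal. A maximal one is the
  -- whole space, which is excluded, so the component is minimal: each of its points is dense in it,
  -- and the T0 axiom leaves a single point.
  have hmin : IsMin t' := (hT' t').resolve_right fun hmax => by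
    have h : (⟨Set.univ, IrreducibleSpace.isIrreducible_univ T, isClosed_univ⟩ :
        IrreducibleCloseds T) ≤ t' := hmax (fun _ _ => trivial)
    exact hne (Set.univ_subset_iff.1 (Set.Subset.trans h (Set.subset_sUnion_of_mem ht)))
  have key : ∀ y ∈ t, closure {y} = t := fun y hy => by
    have hle : closure {y} ⊆ t := (hc t ht).closure_subset_iff.2 (Set.singleton_subset_iff.2 hy)
    exact hle.antisymm (@hmin ⟨closure {y}, isIrreducible_singleton.closure, isClosed_closure⟩ hle)
  intro x hx y hy
  exact (inseparable_iff_closure_eq.2 ((key x hx).trans (key y hy).symm)).eq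

variable {k : Type u} [Field k] (C : Curve k)

lemma Curve.isNoetherian : IsNoetherian C.Xbar := by
  have := C.isProper
  have := LocallyOfFiniteType.isLocallyNoetherian C.str
  have : CompactSpace C.Xbar := QuasiCompact.compactSpace_of_compactSpace C.str
  exact {}

lemma Curve.finite_compl : ((C.X : Set C.Xbar)ᶜ).Finite := by
  have := C.isNoetherian
  refine finite_of_isClosed C.dim_eq_one.le C.X.isOpen.isClosed_compl fun h => ?_
  obtain ⟨x⟩ := C.nonempty
  exact (h.symm.le (Set.mem_univ x.1)) x.2

/-- The spectrum of the stalk embeds topologically into the curve, and dimension does not grow under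
an embedding. -/
lemma Curve.krullDimLE_stalk (x : C.Xbar) : Ring.KrullDimLE 1 (C.Xbar.presheaf.stalk x) := by
  rw [Ring.krullDimLE_iff, ← PrimeSpectrum.topologicalKrullDim_eq_ringKrullDim]
  exact ((C.Xbar.fromSpecStalk x).isEmbedding.isInducing.topologicalKrullDim_le).trans
    C.dim_eq_one.le

/-- In a noetherian local domain of dimension at most one, every nonzero ideal contains a power
of the maximal ideal. -/
lemma exists_maximalIdeal_pow_le {R : Type*} [CommRing R] [IsDomain R] [IsLocalRing R]
    [IsNoetherianRing R] [Ring.KrullDimLE 1 R] {I : Ideal R} (hI : I ≠ ⊥) :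
    ∃ d : ℕ, IsLocalRing.maximalIdeal R ^ d ≤ I := by
  -- It suffices that the maximal ideal lies in the radical, i.e. in every prime containing `I`.
  -- Such a prime is nonzero, hence maximal, hence equal to it.
  refine Ideal.exists_pow_le_of_le_radical_of_fg ?_ (IsNoetherian.noetherian _)
  rw [Ideal.radical_eq_sInf]
  refine le_sInf fun P ⟨hP, hPp⟩ => ?_
  have := Ring.krullDimLE_one_iff_of_noZeroDivisors.1 ‹Ring.KrullDimLE 1 R› P
    (ne_bot_of_le_ne_bot hI hP) hPp
  exact (IsLocalRing.eq_maximalIdeal this).ge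

/-- Every regular function on `X` has poles of bounded order. -/
lemma Curve.exists_mem_poleSpace (f : C.coordRing) : ∃ d, f ∈ C.poleSpace d := by
  have := C.isNoetherian
  have local_bound : ∀ x : C.Xbar, ∃ d : ℕ,
      ∀ t ∈ IsLocalRing.maximalIdeal (C.Xbar.presheaf.stalk x) ^ d,
        algebraMap (C.Xbar.presheaf.stalk x) C.Xbar.functionField t * C.toRat f ∈
          (algebraMap (C.Xbar.presheaf.stalk x) C.Xbar.functionField).range := by
    intro x
    have := C.krullDimLE_stalk x
    -- With `f = a / b` over the local ring at `x`, a power of the maximal ideal contained in `(b)`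
    -- cancels the denominator.
    obtain ⟨a, b, hb, hab⟩ := IsFractionRing.div_surjective
      (A := C.Xbar.presheaf.stalk x) (C.toRat f)
    have hb0 : b ≠ 0 := nonZeroDivisors.ne_zero hb
    obtain ⟨d, hd⟩ := exists_maximalIdeal_pow_le (I := Ideal.span {b})
      (by simpa [Ideal.span_singleton_eq_bot] using hb0)
    refine ⟨d, fun t ht => ?_⟩
    obtain ⟨c, rfl⟩ := Ideal.mem_span_singleton.1 (hd ht)
    refine ⟨c * a, ?_⟩
    have : algebraMap (C.Xbar.presheaf.stalk x) C.Xbar.functionField b ≠ 0 := fun h =>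
      hb0 ((IsFractionRing.injective (C.Xbar.presheaf.stalk x) C.Xbar.functionField)
        (h.trans (map_zero _).symm))
    rw [← hab, map_mul, map_mul]
    field_simp
  choose d hd using local_bound
  -- The local bounds need a maximum only over the finitely many points at infinity.
  obtain ⟨e, he⟩ := (C.finite_compl.image d).bddAbove
  exact ⟨e, fun x hx t ht => hd x t (Ideal.pow_le_pow_right (he ⟨x, hx, rfl⟩) ht)⟩

variable (R : Type u) [CommRing R] [Algebra k R]

lemma exists_mem_range_evScalar (x : R ⊗[k] C.coordRing) :
    ∃ d, x ∈ LinearMap.range (evScalar C R d) := by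
  induction x using TensorProduct.induction_on with
  | zero => exact ⟨0, zero_mem _⟩
  | add x y hx hy =>
    obtain ⟨d, hd⟩ := hx
    obtain ⟨e, he⟩ := hy
    exact ⟨max d e, add_mem (range_evScalar_mono C R (le_max_left d e) hd)
      (range_evScalar_mono C R (le_max_right d e) he)⟩
  | tmul r a =>
    obtain ⟨d, hd⟩ := C.exists_mem_poleSpace a
    exact ⟨d, r ⊗ₜ ⟨a, hd⟩, rfl⟩

lemma exists_mem_range_evLine {N : ℕ} (v : Fin N → R ⊗[k] C.coordRing) :
    ∃ d, v ∈ LinearMap.range (evLine C R N d) := by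
  choose d hd using fun i => exists_mem_range_evScalar C R (v i)
  obtain ⟨e, he⟩ := (Set.finite_range d).bddAbove
  exact ⟨e, (mem_range_evLine C R).2 fun i => range_evScalar_mono C R (he ⟨i, rfl⟩) (hd i)⟩

end Geometry

/-! ### Fibres over `k`-points and their generic points. -/

section FibrePoint

variable {k : Type u} [Field k] {R A : Type u} [CommRing R] [Algebra k R] [CommRing A]
  [Algebra k A]

/-- The `a i` are the members of a `k`-basis of `A` that occur in `x`. Their independence allows the
coefficients `r i` to be recovered from `x` by linear forms. -/
lemma exists_sum_linearIndependent (x : R ⊗[k] A) :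
    ∃ (n : ℕ) (r : Fin n → R) (a : Fin n → A), LinearIndependent k a ∧
      x = ∑ i, r i ⊗ₜ a i := by
  let b := Module.Basis.ofVectorSpace k A
  let c := (b.baseChange R).repr x
  let e := c.support.equivFin
  refine ⟨_, fun i => c (e.symm i), fun i => b (e.symm i),
    b.linearIndependent.comp _ (Subtype.val_injective.comp e.symm.injective), ?_⟩
  conv_lhs => rw [← (b.baseChange R).linearCombination_repr x, Finsupp.linearCombination_apply]
  rw [Finsupp.sum, ← Finset.sum_coe_sort, ← e.symm.sum_comp]
  refine Finset.sum_congr rfl fun i _ => ?_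
  simp [Module.Basis.baseChange_apply, TensorProduct.smul_tmul', c]

/-- A function on `S × X` is the sum of its restriction to a fibre, extended constantly, and of
a combination of functions vanishing at the base point of the fibre. -/
lemma sub_fibre_mem (χ : R →ₐ[k] k) (x : R ⊗[k] A) :
    x - 1 ⊗ₜ fibre A χ x ∈ RingHom.ker χ • (⊤ : Submodule R (R ⊗[k] A)) := by
  induction x using TensorProduct.induction_on with
  | zero => simp
  | add x y hx hy =>
    rw [map_add, TensorProduct.tmul_add, add_sub_add_comm]
    exact add_mem hx hy
  | tmul r a =>
    have : r ⊗ₜ[k] a - 1 ⊗ₜ fibre A χ (r ⊗ₜ a) =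
        (r - algebraMap k R (χ r)) • ((1 : R) ⊗ₜ[k] a) := by
      rw [fibre_tmul, sub_smul, TensorProduct.smul_tmul', smul_eq_mul, mul_one,
        TensorProduct.tmul_smul, algebraMap_smul]
    rw [this]
    refine Submodule.smul_mem_smul ?_ trivial
    rw [RingHom.mem_ker, map_sub, AlgHom.commutes]
    exact sub_self _

lemma form_mem_of_mem_smul_top {Q : Type*} [AddCommGroup Q] [Module R Q] {I : Ideal R}
    (φ : Q →ₗ[R] R) {x : Q} (hx : x ∈ I • (⊤ : Submodule R Q)) : φ x ∈ I := by
  refine Submodule.smul_induction_on hx (fun r hr y _ => ?_) fun x y hx hy => ?_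
  · rw [map_smul]
    exact Ideal.mul_mem_right _ _ hr
  · rw [map_add]
    exact add_mem hx hy

/-- A function which does not vanish identically on a fibre over `S` is a nonzerodivisor near this
fibre. -/
lemma exists_smul_eq_zero [IsDomain A] (χ : R →ₐ[k] k) {x f : R ⊗[k] A} (hxf : x * f = 0)
    (hf : fibre A χ f ≠ 0) : ∃ s : R, χ s ≠ 0 ∧ s • x = 0 := by
  obtain ⟨n, r, a, ha, rfl⟩ := exists_sum_linearIndependent x
  let J : Ideal R := Ideal.span (Set.range r)
  let m : Ideal R := RingHom.ker χ
  -- As `x * f = 0`, the product of `x` with the constant extension of the fibre of `f` equals minus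
  -- the product of `x` with `f - 1 ⊗ fibre f`. The second factor has coefficients in `m`, so all
  -- coefficients of the product lie in `m • J`; it remains to see that these coefficients are the
  -- `r i` themselves.
  have hJ : J ≤ m • J := by
    -- Multiplication by a nonzero element of the domain `A` is injective.
    have haf : LinearIndependent k fun i => a i * fibre A χ f := by
      refine ha.map' (LinearMap.mulRight k (fibre A χ f)) (LinearMap.ker_eq_bot.2 ?_)
      exact fun x y h => mul_right_cancel₀ hf h
    have hmem : (∑ i, r i ⊗ₜ[k] a i) * (1 ⊗ₜ fibre A χ f) ∈
        (m • J) • (⊤ : Submodule R (R ⊗[k] A)) := by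
      have h1 : (∑ i, r i ⊗ₜ[k] a i) * (1 ⊗ₜ fibre A χ f) =
          -∑ i, r i • ((1 ⊗ₜ a i) * (f - 1 ⊗ₜ fibre A χ f)) := by
        have : ∀ i, r i • ((1 ⊗ₜ[k] a i) * (f - 1 ⊗ₜ fibre A χ f)) =
            (r i ⊗ₜ[k] a i) * (f - 1 ⊗ₜ fibre A χ f) := fun i => by
          rw [← smul_mul_assoc, TensorProduct.smul_tmul', smul_eq_mul, mul_one]
        simp only [this, ← Finset.sum_mul]
        rw [mul_sub, hxf, zero_sub, neg_neg]
      rw [h1]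
      refine neg_mem (sum_mem fun i _ => ?_)
      have h2 : (1 ⊗ₜ[k] a i) * (f - 1 ⊗ₜ fibre A χ f) ∈
          m • (⊤ : Submodule R (R ⊗[k] A)) := by
        have := Submodule.mem_map_of_mem (f := LinearMap.mulLeft R (1 ⊗ₜ[k] a i))
          (sub_fibre_mem χ f)
        rw [Submodule.map_smul''] at this
        exact Submodule.smul_mono le_rfl le_top this
      rw [smul_eq_mul, mul_comm m J, Submodule.mul_smul]
      exact Submodule.smul_mem_smul (Ideal.subset_span ⟨i, rfl⟩) h2
    refine Ideal.span_le.2 ?_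
    rintro _ ⟨j, rfl⟩
    -- A form dual to the `j`-th product; its base change reads off `r j`.
    obtain ⟨ψ, hψ⟩ : ∃ ψ : A →ₗ[k] k, ∀ i, ψ (a i * fibre A χ f) = if i = j then 1 else 0 := by
      obtain ⟨g, hg⟩ := LinearMap.exists_extend
        ((Finsupp.lapply j : (Fin n →₀ k) →ₗ[k] k) ∘ₗ haf.repr)
      refine ⟨g, fun i => ?_⟩
      have h := LinearMap.congr_fun hg
        ⟨a i * fibre A χ f, Submodule.subset_span ⟨i, rfl⟩⟩
      simp only [LinearMap.comp_apply, Submodule.subtype_apply] at h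
      rw [h]
      have := haf.repr_eq_single i ⟨a i * fibre A χ f, Submodule.subset_span ⟨i, rfl⟩⟩ rfl
      exact (congrArg (fun v => v j) this).trans (Finsupp.single_apply)
    let Ψ : R ⊗[k] A →ₗ[R] R := (Algebra.linearMap k R ∘ₗ ψ).liftBaseChange R
    have h4 : Ψ ((∑ i, r i ⊗ₜ[k] a i) * (1 ⊗ₜ fibre A χ f)) = r j := by
      rw [Finset.sum_mul, map_sum]
      simp [Ψ, hψ]
    exact h4 ▸ form_mem_of_mem_smul_top Ψ hmem
  have hfg : J.FG := Submodule.fg_span (Set.finite_range r)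
  -- Nakayama's lemma: some `s` congruent to `1` modulo `m` kills `J`. Thus `χ s = 1`, and `s` kills
  -- `x`.
  obtain ⟨s, hs, hs'⟩ := Submodule.exists_sub_one_mem_and_smul_eq_zero_of_fg_of_le_smul m J hfg hJ
  refine ⟨s, fun h0 => ?_, ?_⟩
  · have : χ (s - 1) = 0 := hs
    rw [map_sub, h0, map_one] at this
    simp at this
  · rw [Finset.smul_sum]
    refine Finset.sum_eq_zero fun i _ => ?_
    rw [TensorProduct.smul_tmul', hs' _ (Ideal.subset_span ⟨i, rfl⟩), TensorProduct.zero_tmul]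

/-- The generic point of the fibre of `S × X` over a `k`-point of `S`. -/
def fibrePoint (A : Type u) [CommRing A] [Algebra k A] [IsDomain A] (χ : R →ₐ[k] k) :
    PrimeSpectrum (R ⊗[k] A) :=
  ⟨RingHom.ker (fibre A χ), RingHom.ker_isPrime _⟩

lemma mem_fibrePoint [IsDomain A] {χ : R →ₐ[k] k} {x : R ⊗[k] A} :
    x ∈ (fibrePoint A χ).asIdeal ↔ fibre A χ x = 0 :=
  RingHom.mem_ker

lemma exists_form_ne_zero [IsDomain A] {χ : R →ₐ[k] k} {x : R ⊗[k] A}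
    (hx : x ∉ (fibrePoint A χ).asIdeal) : ∃ φ : R ⊗[k] A →ₗ[R] R, χ (φ x) ≠ 0 :=
  (fibre_ne_zero_iff χ x).2 fun h => hx (mem_fibrePoint.2 h)

variable [IsAlgClosed k] [Algebra.FiniteType k R]

lemma exists_point_of_prime (p : PrimeSpectrum R) :
    ∃ χ : R →ₐ[k] k, ∀ r, χ r ≠ 0 → r ∉ p.asIdeal := by
  obtain ⟨m, hm, hle⟩ := Ideal.exists_le_maximal p.asIdeal p.2.ne_top
  obtain ⟨χ, rfl⟩ := exists_point (k := k) m hm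
  exact ⟨χ, fun r hr hp => hr (hle hp)⟩

lemma ideal_eq_top {I : Ideal R} (h : ∀ χ : R →ₐ[k] k, ∃ s ∈ I, χ s ≠ 0) : I = ⊤ := by
  by_contra hc
  obtain ⟨m, hm, hle⟩ := Ideal.exists_le_maximal I hc
  obtain ⟨χ, rfl⟩ := exists_point (k := k) m hm
  obtain ⟨s, hs, hs'⟩ := h χ
  exact hs' (hle hs)

/-- Open sets are stable under generization. The generic point of a fibre generizes every point of
that fibre, and every point of `S` generizes some closed point, which is a `k`-point. -/
lemma isDomainOpen_iff [IsDomain A] {U : Opens (PrimeSpectrum (R ⊗[k] A))} :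
    IsDomainOpen U ↔ ∀ χ : R →ₐ[k] k, fibrePoint A χ ∈ U := by
  constructor
  · intro hU χ
    obtain ⟨q, hq, hqχ⟩ := hU ⟨RingHom.ker χ, RingHom.ker_isPrime _⟩
    have hle : fibrePoint A χ ≤ q := by
      intro x hx
      have h := sub_fibre_mem χ x
      rw [mem_fibrePoint.1 hx, TensorProduct.tmul_zero, sub_zero] at h
      refine Submodule.smul_induction_on h (fun r hr y _ => ?_) fun x y hx hy => add_mem hx hy
      have hr' : algebraMap R (R ⊗[k] A) r ∈ q.asIdeal := by
        change r ∈ (PrimeSpectrum.comap (algebraMap R (R ⊗[k] A)) q).asIdeal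
        rw [hqχ]
        exact hr
      rw [Algebra.smul_def]
      exact Ideal.mul_mem_right _ _ hr'
    exact ((PrimeSpectrum.le_iff_specializes _ _).1 hle).mem_open U.isOpen hq
  · intro h p
    obtain ⟨m, hm, hle⟩ := Ideal.exists_le_maximal p.asIdeal p.2.ne_top
    obtain ⟨χ, rfl⟩ := exists_point (k := k) m hm
    -- The projection `S × X → S` is a base change of a scheme over a field, hence open. The image
    -- of `U` contains the closed point of `χ`, and with it every generization `p`.
    have ho : IsOpen (PrimeSpectrum.comap (algebraMap R (R ⊗[k] A)) '' (U : Set _)) :=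
      PrimeSpectrum.isOpenMap_comap_algebraMap_tensorProduct_of_field _ U.isOpen
    have hspec : p ⤳ PrimeSpectrum.comap (algebraMap R (R ⊗[k] A)) (fibrePoint A χ) := by
      rw [← PrimeSpectrum.le_iff_specializes]
      intro r hr
      have hr' : χ r = 0 := hle hr
      change fibre A χ (r ⊗ₜ 1) = 0
      rw [fibre_tmul, hr', zero_smul]
    exact hspec.mem_open ho ⟨_, h χ, rfl⟩

/-- A line sub-bundle is generated by one section near every `k`-point. -/
lemma IsLineSubbundle.exists_generator {Q : Type u} [AddCommGroup Q] [Module R Q]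
    {W : Submodule R Q} (hW : IsLineSubbundle W) (χ : R →ₐ[k] k) :
    ∃ w ∈ W, ∃ φ : Q →ₗ[R] R, χ (φ w) ≠ 0 ∧ ∀ v ∈ W, φ w • v = φ v • w := by
  -- Any section on which some form is nonzero at `χ` will do: in a line bundle `φ w • v = φ v • w`,
  -- so `w` generates wherever `φ w` is invertible.
  obtain ⟨w, hw, φ, hφ⟩ := (isUnimodular_iff (k := k) _).1 hW.isUnimodular χ
  have := hW.invertible
  exact ⟨w, hw, φ, hφ, fun v hv =>
    congrArg Subtype.val (smul_swap (φ ∘ₗ W.subtype) ⟨w, hw⟩ ⟨v, hv⟩)⟩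

lemma isLineSubbundle_span_singleton {Q : Type u} [AddCommGroup Q] [Module R Q]
    [Module.Projective R Q] {w : Q} (h : ∀ χ : R →ₐ[k] k, ∃ φ : Q →ₗ[R] R, χ (φ w) ≠ 0) :
    IsLineSubbundle (Submodule.span R {w}) := by
  rw [← LinearMap.range_toSpanSingleton]
  refine isLineSubbundle_range' _ ((isUnimodular_iff (k := k) _).2 fun χ => ?_)
  exact ⟨w, ⟨1, by simp⟩, h χ⟩

end FibrePoint

/-! ### Cancellation in products of line sub-bundles. -/

section Freeness

variable {k : Type u} [Field k] [IsAlgClosed k] {R A : Type u} [CommRing R] [Algebra k R]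
  [CommRing A] [Algebra k A] [IsDomain A] [Algebra.FiniteType k R]

/-- Near each `k`-point `M'` and `W` have generators `m` and `w`, so `x • w` is locally a multiple
of `m • w`. A coordinate of `w` that is nonzero on the fibre can be cancelled after shrinking, which
puts `x` into `M'` locally. -/
lemma le_of_smul_le_smul {N : ℕ} {M M' : Submodule R (R ⊗[k] A)}
    {W : Submodule R (Fin N → R ⊗[k] A)} (hM' : IsLineSubbundle M') (hW : IsLineSubbundle W)
    (h : M • W ≤ M' • W) : M ≤ M' := by
  intro x hx
  -- The elements of `R` that multiply `x` into `M'` form an ideal; it is the unit ideal once it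
  -- contains, for every `χ`, an element with nonzero value there.
  suffices hI : M'.colon {x} = ⊤ by
    simpa [Submodule.mem_colon_singleton] using (Ideal.eq_top_iff_one _).1 hI
  refine ideal_eq_top (k := k) fun χ => ?_
  obtain ⟨w, hw, φ, hφ, hφ'⟩ := hW.exists_generator χ
  obtain ⟨m, hm, ψ, hψ, hψ'⟩ := hM'.exists_generator χ
  obtain ⟨i, hi⟩ := (fibre_ne_zero_iff_pi χ w).1 ⟨φ, hφ⟩
  have key : ∀ y ∈ M' • W, ∃ r : R, (ψ m * φ w) • y = r • (m • w) := by
    intro y hy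
    refine Submodule.smul_induction_on hy (fun a ha v hv => ⟨ψ a * φ v, ?_⟩) ?_
    · calc (ψ m * φ w) • (a • v) = (ψ m • a) • (φ w • v) := by
            rw [smul_smul_smul_comm, smul_eq_mul]
        _ = (ψ a * φ v) • (m • w) := by
            rw [hψ' a ha, hφ' v hv, smul_smul_smul_comm, smul_eq_mul]
    · rintro y z ⟨r, hr⟩ ⟨s, hs⟩
      exact ⟨r + s, by rw [smul_add, hr, hs, add_smul]⟩
  obtain ⟨r, hr⟩ := key _ (h (Submodule.smul_mem_smul hx hw))
  have h0 : ((ψ m * φ w) • x - r • m) * w i = 0 := by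
    have := congrFun hr i
    simp only [Pi.smul_apply, smul_eq_mul] at this
    rw [sub_mul, smul_mul_assoc, this, smul_mul_assoc, sub_self]
  -- The ring of functions on `S × X` may have zero divisors, so `w i` cannot be cancelled outright;
  -- the price is the factor `s`, invertible near `χ`.
  obtain ⟨s, hs, hs'⟩ := exists_smul_eq_zero χ h0 hi
  refine ⟨s * (ψ m * φ w), ?_, ?_⟩
  · rw [Submodule.mem_colon_singleton, mul_smul, ← sub_add_cancel ((ψ m * φ w) • x) (r • m),
      smul_add, hs', zero_add]
    exact M'.smul_mem _ (M'.smul_mem _ hm)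
  · rw [map_mul, map_mul]
    exact mul_ne_zero hs (mul_ne_zero hψ hφ)

lemma smul_right_cancel {N : ℕ} {M M' : Submodule R (R ⊗[k] A)}
    {W : Submodule R (Fin N → R ⊗[k] A)} (hM : IsLineSubbundle M) (hM' : IsLineSubbundle M')
    (hW : IsLineSubbundle W) (h : M • W = M' • W) : M = M' :=
  le_antisymm (le_of_smul_le_smul hM' hW h.le) (le_of_smul_le_smul hM hW h.ge)

end Freeness

/-! ### Equality of generic lines, and invariance under scalars. -/

section Restriction

/-- The restriction of a line sub-bundle to a smaller open subset. -/
def LineSubbundle.restrict {N : ℕ} {B : Type u} [CommRing B] {U V : Opens (PrimeSpectrum B)}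
    (l : LineSubbundle N U) (h : V ≤ U) : LineSubbundle N V where
  stalk q hq := l.stalk q (h hq)
  locally_eq q hq := by
    obtain ⟨b, hb, _, W, hW, hs⟩ := l.locally_eq q (h hq)
    obtain ⟨_, ⟨c, rfl⟩, hc, hcV⟩ :=
      PrimeSpectrum.isTopologicalBasis_basic_opens.exists_subset_of_mem_open hq V.isOpen
    refine ⟨b * c, fun hbc => (q.2.mem_or_mem hbc).elim hb hc, fun q' hq' =>
      hcV fun hc' => hq' (Ideal.mul_mem_left _ _ hc'), W, ?_, fun q' hq' hb' =>
      hs q' _ fun hb'' => hb' (Ideal.mul_mem_right _ _ hb'')⟩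
    have hu : IsUnit (algebraMap B (Localization.Away (b * c)) b) :=
      isUnit_of_mul_isUnit_left (y := algebraMap B _ c)
        (by rw [← map_mul]; exact IsLocalization.Away.algebraMap_isUnit (b * c))
    have := hW.extend (IsLocalization.Away.lift b hu)
    rwa [extend_extend, IsLocalization.Away.lift_comp] at this

variable {k : Type u} [Field k] {N : ℕ} {R A : Type u} [CommRing R] [CommRing A] [Algebra k R]
  [Algebra k A]

/-- Both representatives have the same restriction to `V`, so two generating relations of the
colimit connect them. -/
lemma GenericLine.mk_eq_mk (l l' : LineOnDomain k N R A) (V : Opens (PrimeSpectrum (R ⊗[k] A)))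
    (hV : IsDomainOpen V) (h : V ≤ l.U) (h' : V ≤ l'.U)
    (hs : ∀ q (hq : q ∈ V), l.line.stalk q (h hq) = l'.line.stalk q (h' hq)) :
    (Quot.mk _ l : GenericLine k N R A) = Quot.mk _ l' :=
  (Quot.sound (b := ⟨V, hV, l.line.restrict h⟩) ⟨h, fun _ _ => rfl⟩).trans
    (Quot.sound (a := l') ⟨h', hs⟩).symm

variable [IsAlgClosed k] [IsDomain A] [Algebra.FiniteType k R]

/-- The stalk of a generic line at the generic point of a fibre over `S`. -/
def GenericLine.stalkAt (χ : R →ₐ[k] k) (l : GenericLine k N R A) :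
    Submodule (Localization.AtPrime (fibrePoint A χ).asIdeal)
      (Fin N → Localization.AtPrime (fibrePoint A χ).asIdeal) :=
  -- Every domain contains this point, so the stalk exists for each representative and is unchanged
  -- by restriction.
  Quot.lift (fun l : LineOnDomain k N R A =>
    l.line.stalk (fibrePoint A χ) (isDomainOpen_iff.1 l.isDomainOpen χ))
    (fun _ _ ⟨_, h⟩ => (h _ _).symm) l

/-- The generic line given by a line sub-bundle of the module of vectors of functions. -/
def genericLineOf (W : Submodule R (Fin N → R ⊗[k] A)) (hW : IsLineSubbundle W) :
    GenericLine k N R A :=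
  Quot.mk _ (lineOf W hW)

/-- At a point where `M • W` has a section that does not vanish, some product `m • w` does not
vanish either. Then `W` has a nonvanishing section there, and `m` is a unit of the local ring, so
both modules have the same span. -/
lemma genericLineOf_smul {M : Submodule R (R ⊗[k] A)} {W : Submodule R (Fin N → R ⊗[k] A)}
    (hW : IsLineSubbundle W) (hMW : IsLineSubbundle (M • W)) :
    genericLineOf (M • W) hMW = genericLineOf W hW := by
  have exists_factors : ∀ q ∈ (lineOf (M • W) hMW).U,
      ∃ m ∈ M, ∃ w ∈ W, ∃ i, (m • w) i ∉ q.asIdeal := by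
    rintro q ⟨v, hv, i, hi⟩
    by_contra! hc
    apply hi
    refine Submodule.smul_induction_on hv (fun m hm w hw => hc m hm w hw i) fun x y hx hy => ?_
    exact add_mem hx hy
  refine (Quot.sound ⟨fun q hq => ?_, fun q hq => ?_⟩).symm
  · obtain ⟨m, _, w, hw, i, hi⟩ := exists_factors q hq
    exact ⟨w, hw, i, fun h => hi (Ideal.mul_mem_left _ _ h)⟩
  · obtain ⟨m, hm, w, _, i, hi⟩ := exists_factors q hq
    have hm' : m ∉ q.asIdeal := fun h => hi (Ideal.mul_mem_right _ _ h)
    let σ := algebraMap (R ⊗[k] A) (Localization.AtPrime q.asIdeal)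
    have hmul : ∀ (a : R ⊗[k] A) (v : Fin N → R ⊗[k] A),
        coordMap N σ (a • v) = σ a • coordMap N σ v := fun a v => map_smulₛₗ _ _ _
    change Submodule.span _ (coordMap N σ '' _) = Submodule.span _ (coordMap N σ '' _)
    apply le_antisymm
    · refine Submodule.span_le.2 ?_
      rintro _ ⟨v, hv, rfl⟩
      refine Submodule.smul_induction_on hv (fun a _ u hu => ?_) fun x y hx hy => ?_
      · rw [hmul]
        exact Submodule.smul_mem _ _ (Submodule.subset_span ⟨u, hu, rfl⟩)
      · rw [map_add]
        exact add_mem hx hy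
    · refine Submodule.span_le.2 ?_
      rintro _ ⟨v, hv, rfl⟩
      have hu : IsUnit (σ m) := IsLocalization.map_units _ (⟨m, hm'⟩ : q.asIdeal.primeCompl)
      refine (Submodule.smul_mem_iff_of_isUnit _ hu).1 ?_
      rw [← hmul]
      exact Submodule.subset_span ⟨_, Submodule.smul_mem_smul hm hv, rfl⟩

end Restriction

/-! ### Sections defining the same generic line are proportional. -/

section Proportional

variable {k : Type u} [Field k] [IsAlgClosed k] {N : ℕ} {R A : Type u} [CommRing R] [CommRing A]
  [Algebra k R] [Algebra k A] [IsDomain A] [Algebra.FiniteType k R]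

/-- The two stalks at the generic point of the fibre agree, and the second lies in the span of `w'`
because `t` is a unit there. Hence `w` is a multiple of `w'` over the local ring, and clearing
denominators gives the relation. -/
lemma exists_smul_eq_smul {W W' : Submodule R (Fin N → R ⊗[k] A)} (hW : IsLineSubbundle W)
    (hW' : IsLineSubbundle W') (h : genericLineOf W hW = genericLineOf W' hW')
    {χ : R →ₐ[k] k} {w w' : Fin N → R ⊗[k] A} (hw : w ∈ W) {t : R} (ht : χ t ≠ 0)
    (hgen : ∀ v ∈ W', ∃ r : R, t • v = r • w') {i : Fin N} (hi : fibre A χ (w i) ≠ 0) :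
    ∃ m m' : R ⊗[k] A, m ∉ (fibrePoint A χ).asIdeal ∧ m' ∉ (fibrePoint A χ).asIdeal ∧
      m • w = m' • w' := by
  let q := fibrePoint A χ
  let O := Localization.AtPrime q.asIdeal
  let σ : R ⊗[k] A →+* O := algebraMap (R ⊗[k] A) O
  have ht' : algebraMap R (R ⊗[k] A) t ∉ q.asIdeal := by
    intro hc
    have : fibre A χ (t ⊗ₜ 1) = 0 := mem_fibrePoint.1 hc
    rw [fibre_tmul, smul_eq_zero] at this
    exact this.elim ht one_ne_zero
  have hstalk : Submodule.span O (coordMap N σ '' (W : Set _)) =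
      Submodule.span O (coordMap N σ '' (W' : Set _)) :=
    congrArg (GenericLine.stalkAt χ) h
  have hle : Submodule.span O (coordMap N σ '' (W' : Set _)) ≤
      Submodule.span O {coordMap N σ w'} := by
    refine Submodule.span_le.2 ?_
    rintro _ ⟨v, hv, rfl⟩
    obtain ⟨r, hr⟩ := hgen v hv
    have hu : IsUnit (σ (algebraMap R _ t)) :=
      IsLocalization.map_units _ (⟨_, ht'⟩ : q.asIdeal.primeCompl)
    refine (Submodule.smul_mem_iff_of_isUnit _ hu).1 ?_
    have : σ (algebraMap R _ t) • coordMap N σ v = σ (algebraMap R _ r) • coordMap N σ w' := by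
      rw [← map_smulₛₗ, ← map_smulₛₗ, algebraMap_smul, algebraMap_smul, hr]
    rw [this]
    exact Submodule.smul_mem _ _ (Submodule.mem_span_singleton_self _)
  have hmem : coordMap N σ w ∈ Submodule.span O {coordMap N σ w'} :=
    hle (hstalk ▸ Submodule.subset_span ⟨w, hw, rfl⟩)
  obtain ⟨c, hc⟩ := Submodule.mem_span_singleton.1 hmem
  obtain ⟨a, b, rfl⟩ := IsLocalization.exists_mk'_eq q.asIdeal.primeCompl c
  have hcoord : ∀ j, σ (a * w' j) = σ (b * w j) := by
    intro j
    have := congrFun hc j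
    change IsLocalization.mk' O a b * σ (w' j) = σ (w j) at this
    rw [map_mul, map_mul, ← this, ← mul_assoc, mul_comm (σ b), IsLocalization.mk'_spec]
  -- An equality in the localization holds in the ring only after multiplication by some `d j`; the
  -- product of all of them serves every coordinate at once.
  choose d hd using fun j => (IsLocalization.eq_iff_exists q.asIdeal.primeCompl O).1 (hcoord j)
  let e : q.asIdeal.primeCompl := ∏ j, d j
  have he : ∀ j, (e : R ⊗[k] A) * (a * w' j) = e * (b * w j) := by
    intro j
    obtain ⟨g, hg⟩ : d j ∣ e := Finset.dvd_prod_of_mem d (Finset.mem_univ j)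
    rw [hg, Submonoid.coe_mul, mul_comm (d j : R ⊗[k] A), mul_assoc, hd, mul_assoc]
  have heb : (e * b : R ⊗[k] A) ∉ q.asIdeal := (e * b).2
  -- The factor `e * b` is a denominator, hence nonzero on the fibre. For `e * a` the coordinate `i`
  -- is used: if it vanished on the fibre, so would `e * b * w i`.
  refine ⟨e * b, e * a, heb, fun hc' => ?_, funext fun j => ?_⟩
  · have h1 : (e * b : R ⊗[k] A) * w i ∈ q.asIdeal := by
      rw [mul_assoc, ← he, ← mul_assoc]
      exact Ideal.mul_mem_right _ _ hc'
    exact (q.2.mem_or_mem h1).elim heb fun h2 => hi (mem_fibrePoint.1 h2)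
  · rw [Pi.smul_apply, Pi.smul_apply, smul_eq_mul, smul_eq_mul, mul_assoc, mul_assoc, he]

end Proportional

/-! ### Local generators of generic lines. -/

section LocalGenerator

variable {k : Type u} [Field k] [IsAlgClosed k] {N : ℕ} {R A : Type u} [CommRing R] [CommRing A]
  [Algebra k R] [Algebra k A] [IsDomain A] [Algebra.FiniteType k R]

/-- Near the generic point of a fibre a generic line is spanned by a vector of functions. -/
lemma LineOnDomain.exists_generator (l : LineOnDomain k N R A) (χ : R →ₐ[k] k) :
    ∃ (w : Fin N → R ⊗[k] A) (h : R ⊗[k] A) (i : Fin N), h ∉ (fibrePoint A χ).asIdeal ∧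
      w i ∣ h ∧ ∀ q : PrimeSpectrum (R ⊗[k] A), h ∉ q.asIdeal → ∃ hq : q ∈ l.U,
        l.line.stalk q hq = Submodule.span (Localization.AtPrime q.asIdeal)
          {coordMap N (algebraMap _ (Localization.AtPrime q.asIdeal)) w} := by
  obtain ⟨b, hb, hbU, W, hW, hs⟩ := l.line.locally_eq (fibrePoint A χ)
    (isDomainOpen_iff.1 l.isDomainOpen χ)
  obtain ⟨w, hw, i, hi⟩ : ∃ w ∈ W, ∃ i, w i ∉ (fibrePoint A χ).asIdeal := by
    -- If all coordinates of all sections vanished at this point, every linear form on the stalk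
    -- would take values in the maximal ideal, against unimodularity.
    by_contra! hc
    let O := Localization.AtPrime (fibrePoint A χ).asIdeal
    have hline : IsLineSubbundle (extend (algebraMap (R ⊗[k] A) O) W) := by
      have hu : IsUnit (algebraMap (R ⊗[k] A) O b) :=
        IsLocalization.map_units _ (⟨b, hb⟩ : (fibrePoint A χ).asIdeal.primeCompl)
      have := hW.extend (IsLocalization.Away.lift b hu)
      rwa [extend_extend, IsLocalization.Away.lift_comp] at this
    have hle : Ideal.span {r : O | ∃ f : (Fin N → O) →ₗ[O] O,
        ∃ w ∈ (extend (algebraMap (R ⊗[k] A) O) W : Set (Fin N → O)), f w = r} ≤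
          IsLocalRing.maximalIdeal O := by
      refine Ideal.span_le.2 ?_
      rintro _ ⟨f, v, hv, rfl⟩
      induction hv using Submodule.span_induction with
      | zero => rw [map_zero]; exact zero_mem _
      | add x y _ _ hx hy => rw [map_add]; exact add_mem hx hy
      | smul c x _ hx => rw [map_smul]; exact Ideal.mul_mem_left _ _ hx
      | mem x hx =>
        obtain ⟨w, hw, rfl⟩ := hx
        rw [LinearMap.pi_apply_eq_sum_univ f]
        refine sum_mem fun i _ => Ideal.mul_mem_right _ _ ?_
        exact (IsLocalization.AtPrime.to_map_mem_maximal_iff O (fibrePoint A χ).asIdeal _).2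
          (hc w hw i)
    rw [hline.isUnimodular] at hle
    exact (IsLocalRing.maximalIdeal.isMaximal O).ne_top (top_unique hle)
  -- The factor `b` keeps the point inside the chart where the line comes from `W`; the factor `w i`
  -- makes `w` a generator, since `w i • v = v i • w` for all sections `v`.
  refine ⟨w, b * w i, i, fun hc => ((fibrePoint A χ).2.mem_or_mem hc).elim hb hi,
    Dvd.intro_left _ rfl, fun q hq => ?_⟩
  have hbq : b ∉ q.asIdeal := fun h => hq (Ideal.mul_mem_right _ _ h)
  have hwq : w i ∉ q.asIdeal := fun h => hq (Ideal.mul_mem_left _ _ h)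
  refine ⟨hbU hbq, ?_⟩
  rw [hs q (hbU hbq) hbq]
  let O := Localization.AtPrime q.asIdeal
  let σ := algebraMap (R ⊗[k] A) O
  have hline : IsLineSubbundle (extend σ W) := by
    have hu : IsUnit (σ b) := IsLocalization.map_units _ (⟨b, hbq⟩ : q.asIdeal.primeCompl)
    have := hW.extend (IsLocalization.Away.lift b hu)
    rwa [extend_extend, IsLocalization.Away.lift_comp] at this
  have hmem : ∀ v ∈ W, coordMap N σ v ∈ extend σ W := fun v hv => Submodule.subset_span ⟨v, hv, rfl⟩
  refine le_antisymm (Submodule.span_le.2 ?_)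
    (Submodule.span_le.2 (Set.singleton_subset_iff.2 (hmem w hw)))
  rintro _ ⟨v, hv, rfl⟩
  have := hline.invertible
  have hswap : σ (w i) • coordMap N σ v = σ (v i) • coordMap N σ w := congrArg Subtype.val (smul_swap (LinearMap.proj i ∘ₗ (extend σ W).subtype)
    ⟨_, hmem w hw⟩ ⟨_, hmem v hv⟩)
  have hu : IsUnit (σ (w i)) := IsLocalization.map_units _ (⟨w i, hwq⟩ : q.asIdeal.primeCompl)
  refine (Submodule.smul_mem_iff_of_isUnit _ hu).1 ?_
  change σ (w i) • coordMap N σ v ∈ _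
  rw [hswap]
  exact Submodule.smul_mem _ _ (Submodule.mem_span_singleton_self _)

end LocalGenerator

/-! ### Shrinking the base, and points spanned by one section. -/

section BaseChange

variable {k : Type u} [Field k]

lemma exists_basicOpen (S : (Aff k)ᵒᵖ) (r : fn S) :
    ∃ (O : (Aff k)ᵒᵖ) (j : S ⟶ O), IsBasicOpen (pb j).toRingHom r := by
  have hft := finiteType_away (k := k) r
  let O : Aff k := Aff.spec (Localization.Away r)
  let j : O ⟶ S.unop := Quiver.Hom.op (ObjectProperty.homMk (CommAlgCat.ofHom
    (IsScalarTower.toAlgHom k (fn S) (Localization.Away r))))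
  exact ⟨op O, j.op, isBasicOpen_algebraMap r⟩

lemma IsBasicOpen.isUnit {R R' : Type*} [CommRing R] [CommRing R'] {φ : R →+* R'} {r : R}
    (h : IsBasicOpen φ r) : IsUnit (φ r) := by
  let := φ.toAlgebra
  have : IsLocalization.Away r R' := h
  exact IsLocalization.Away.algebraMap_isUnit r

lemma map_ne_zero_of_isUnit {R' : Type u} [CommRing R'] [Algebra k R'] {r : R'} (h : IsUnit r)
    (χ : R' →ₐ[k] k) : χ r ≠ 0 :=
  (h.map χ).ne_zero

/-- Passes from a generator up to the factor `t` to an honest generator, over a base on which `t` is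
invertible. -/
lemma span_image_eq_span_singleton {R R' Q Q' : Type*} [CommRing R] [CommRing R']
    [AddCommGroup Q] [AddCommGroup Q'] [Module R Q] [Module R' Q'] {σ : R →+* R'}
    (f : Q →ₛₗ[σ] Q') {W : Submodule R Q} {w : Q} (hw : w ∈ W) {t : R} (ht : IsUnit (σ t))
    (hgen : ∀ v ∈ W, ∃ r : R, t • v = r • w) :
    Submodule.span R' (f '' (W : Set Q)) = Submodule.span R' {f w} := by
  refine le_antisymm (Submodule.span_le.2 ?_) (Submodule.span_mono ?_)
  · rintro _ ⟨v, hv, rfl⟩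
    obtain ⟨r, hr⟩ := hgen v hv
    refine (Submodule.smul_mem_iff_of_isUnit _ ht).1 ?_
    rw [← map_smulₛₗ, hr, map_smulₛₗ]
    exact Submodule.smul_mem _ _ (Submodule.mem_span_singleton_self _)
  · exact Set.singleton_subset_iff.2 ⟨w, hw, rfl⟩

lemma span_singleton_smul_span_singleton {R B Q : Type*} [CommRing R] [CommRing B] [Algebra R B]
    [AddCommGroup Q] [Module R Q] [Module B Q] [IsScalarTower R B Q] (b : B) (x : Q) :
    Submodule.span R {b} • Submodule.span R {x} = Submodule.span R {b • x} := by
  refine le_antisymm (Submodule.smul_le.2 fun a ha v hv => ?_)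
    (Submodule.span_le.2 (Set.singleton_subset_iff.2 (Submodule.smul_mem_smul
      (Submodule.mem_span_singleton_self b) (Submodule.mem_span_singleton_self x))))
  obtain ⟨r, rfl⟩ := Submodule.mem_span_singleton.1 ha
  obtain ⟨s, rfl⟩ := Submodule.mem_span_singleton.1 hv
  rw [smul_assoc, smul_algebra_smul_comm s b x]
  exact Submodule.smul_mem _ _ (Submodule.smul_mem _ _ (Submodule.mem_span_singleton_self _))

variable {R R' : Type u} [CommRing R] [Algebra k R] [CommRing R'] [Algebra k R']

/-- Linear forms extend along base change, and the extension of `ψ` has a unit value on the pull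
back of `m`. This spreads nonvanishing from one fibre to all fibres over a neighbourhood. -/
lemma fibre_bcVec_ne_zero {A : Type u} [CommRing A] [Algebra k A] (φ : R →ₐ[k] R')
    {m : R ⊗[k] A} {ψ : R ⊗[k] A →ₗ[R] R} (hψ : IsUnit (φ (ψ m))) (χ : R' →ₐ[k] k) :
    fibre A χ (bcVec A φ m) ≠ 0 := by
  obtain ⟨ψ', hψ'⟩ := bcVec_extends A φ ψ
  refine (fibre_ne_zero_iff χ _).1 ⟨ψ', ?_⟩
  rw [hψ']
  exact map_ne_zero_of_isUnit hψ χ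

variable [IsAlgClosed k] (C : Curve k) [Algebra.FiniteType k R']

/-- Nonvanishing on all fibres gives the line sub-bundle; the boundedness of poles places it in some
`𝓜_d`. -/
lemma isScalarPoint_span_singleton {m : R' ⊗[k] C.coordRing}
    (h : ∀ χ : R' →ₐ[k] k, fibre C.coordRing χ m ≠ 0) :
    IsScalarPoint C R' (Submodule.span R' {m}) := by
  rw [isScalarPoint_iff]
  refine ⟨isLineSubbundle_span_singleton (k := k) fun χ => (fibre_ne_zero_iff χ m).2 (h χ), ?_⟩
  obtain ⟨d, hd⟩ := exists_mem_range_evScalar C R' m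
  exact ⟨d, Submodule.span_le.2 (Set.singleton_subset_iff.2 hd)⟩

lemma isLinePoint_span_singleton {N : ℕ} {w : Fin N → R' ⊗[k] C.coordRing}
    (h : ∀ χ : R' →ₐ[k] k, ∃ i, fibre C.coordRing χ (w i) ≠ 0) :
    IsLinePoint C R' (Submodule.span R' {w}) := by
  rw [isLinePoint_iff]
  refine ⟨isLineSubbundle_span_singleton (k := k) fun χ =>
    (fibre_ne_zero_iff_pi χ w).2 (h χ), ?_⟩
  obtain ⟨d, hd⟩ := exists_mem_range_evLine C R' w
  exact ⟨d, Submodule.span_le.2 (Set.singleton_subset_iff.2 hd)⟩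

lemma lineOf_span_singleton_stalk {N : ℕ} {A : Type u} [CommRing A] [Algebra k A] [IsDomain A]
    {w : Fin N → R' ⊗[k] A} (hW : IsLineSubbundle (Submodule.span R' {w}))
    (q : PrimeSpectrum (R' ⊗[k] A)) (hq : q ∈ (lineOf (Submodule.span R' {w}) hW).U) :
    (lineOf (Submodule.span R' {w}) hW).line.stalk q hq =
      Submodule.span (Localization.AtPrime q.asIdeal)
        {coordMap N (algebraMap (R' ⊗[k] A) (Localization.AtPrime q.asIdeal)) w} := by
  change Submodule.span (Localization.AtPrime q.asIdeal)
    (coordMapOver N R' (algebraMap (R' ⊗[k] A) (Localization.AtPrime q.asIdeal)) ''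
      (Submodule.span R' {w} : Set (Fin N → R' ⊗[k] A))) = _
  rw [span_image_span, Set.image_singleton]
  rfl

lemma extend_span_singleton {N : ℕ} {B B' : Type*} [CommRing B] [CommRing B'] (σ : B →+* B')
    (v : Fin N → B) : extend σ (Submodule.span B {v}) = Submodule.span B' {coordMap N σ v} := by
  rw [extend, span_image_span, Set.image_singleton]

end BaseChange

/-! ### Local structure of the map `F_∞`. -/

section Main

variable {k : Type u} [Field k] [IsAlgClosed k] (C : Curve k) {N : ℕ}

lemma toGeneric_smul {S : (Aff k)ᵒᵖ} (m : (scalars C).obj S) (f : (lines C N).obj S) :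
    (toGeneric C N).app S (m • f) = (toGeneric C N).app S f :=
  genericLineOf_smul ((isLinePoint_iff C).1 f.2).1 ((isLinePoint_iff C).1 (m • f).2).1

lemma smul_injective {S : (Aff k)ᵒᵖ} {m n : (scalars C).obj S} {f : (lines C N).obj S}
    (h : m • f = n • f) : m = n :=
  Subtype.ext (smul_right_cancel ((isScalarPoint_iff C).1 m.2).1 ((isScalarPoint_iff C).1 n.2).1
    ((isLinePoint_iff C).1 f.2).1 (congrArg Subtype.val h))

/-- Near a `k`-point in the closure of `p`, generators of `f` and `g` satisfy `m • w = m' • w'`. On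
a small basic open set all four elements span line sub-bundles, and the spans of `m` and `m'` are
the required scalars. -/
lemma exists_smul_eq_smul_of_toGeneric_eq {S : (Aff k)ᵒᵖ} {f g : (lines C N).obj S}
    (h : (toGeneric C N).app S f = (toGeneric C N).app S g) (p : PrimeSpectrum (fn S)) :
    ∃ r : fn S, r ∉ p.asIdeal ∧
      ∃ (O : (Aff k)ᵒᵖ) (j : S ⟶ O), IsBasicOpen (pb j).toRingHom r ∧
        ∃ m₁ m₂ : (scalars C).obj O,
          m₁ • (lines C N).map j f = m₂ • (lines C N).map j g := by
  have hft : Algebra.FiniteType k (fn S) := S.unop.unop.property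
  obtain ⟨χ, hχ⟩ := exists_point_of_prime (k := k) p
  have hf := ((isLinePoint_iff C).1 f.2).1
  have hg := ((isLinePoint_iff C).1 g.2).1
  obtain ⟨w, hw, φ, hφ, hφ'⟩ := hf.exists_generator χ
  obtain ⟨w', hw', φ', hφ₂, hφ₂'⟩ := hg.exists_generator χ
  obtain ⟨i, hi⟩ := (fibre_ne_zero_iff_pi χ w).1 ⟨φ, hφ⟩
  obtain ⟨m, m', hm, hm', hmw⟩ := exists_smul_eq_smul hf hg h hw hφ₂
    (fun v hv => ⟨_, hφ₂' v hv⟩) hi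
  obtain ⟨ψ, hψ⟩ := exists_form_ne_zero hm
  obtain ⟨ψ', hψ'⟩ := exists_form_ne_zero hm'
  -- Inverting the first two factors makes `w` and `w'` generators; inverting the last two keeps `m`
  -- and `m'` nonzero on every fibre.
  let t := (φ w * φ' w') * (ψ m * ψ' m')
  have ht : χ t ≠ 0 := by
    simp only [t, map_mul]
    exact mul_ne_zero (mul_ne_zero hφ hφ₂) (mul_ne_zero hψ hψ')
  obtain ⟨O, j, hj⟩ := exists_basicOpen S t
  have hftO : Algebra.FiniteType k (fn O) := O.unop.unop.property
  have hu : IsUnit (pb j t) := hj.isUnit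
  simp only [t, map_mul] at hu
  obtain ⟨hu₁, hu₂⟩ := (IsUnit.mul_iff.1 hu).imp IsUnit.mul_iff.1 IsUnit.mul_iff.1
  let m₁ : (scalars C).obj O := ⟨_, isScalarPoint_span_singleton C
    fun χ' => fibre_bcVec_ne_zero (pb j) hu₂.1 χ'⟩
  let m₂ : (scalars C).obj O := ⟨_, isScalarPoint_span_singleton C
    fun χ' => fibre_bcVec_ne_zero (pb j) hu₂.2 χ'⟩
  refine ⟨t, hχ t ht, O, j, hj, m₁, m₂, Subtype.ext ?_⟩
  have e : ∀ b v, bcPi C N (pb j) (b • v) = bcVec C.coordRing (pb j) b • bcPi C N (pb j) v :=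
    fun b v => funext fun i => map_mul (bcRing C.coordRing (pb j)) b (v i)
  change Submodule.span (fn O) {bcVec C.coordRing (pb j) m} •
      Submodule.span (fn O) (bcPi C N (pb j) '' (f.1 : Set _)) =
    Submodule.span (fn O) {bcVec C.coordRing (pb j) m'} •
      Submodule.span (fn O) (bcPi C N (pb j) '' (g.1 : Set _))
  rw [span_image_eq_span_singleton (bcPi C N (pb j)) hw hu₁.1 fun v hv => ⟨_, hφ' v hv⟩,
    span_image_eq_span_singleton (bcPi C N (pb j)) hw' hu₁.2 fun v hv => ⟨_, hφ₂' v hv⟩,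
    span_singleton_smul_span_singleton, span_singleton_smul_span_singleton, ← e, ← e, hmw]

/-- The lift is the span of a local generator `w`, over the basic open set on which a coefficient of
`h` is invertible. As `w i` divides `h`, it too is nonzero on every fibre, so `w` spans a point of
`𝓛_∞`. -/
lemma exists_toGeneric_eq {S : (Aff k)ᵒᵖ} (l : (genericLines C N).obj S)
    (p : PrimeSpectrum (fn S)) :
    ∃ r : fn S, r ∉ p.asIdeal ∧
      ∃ (O : (Aff k)ᵒᵖ) (j : S ⟶ O), IsBasicOpen (pb j).toRingHom r ∧
        ∃ f : (lines C N).obj O, (toGeneric C N).app O f = (genericLines C N).map j l := by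
  have hft : Algebra.FiniteType k (fn S) := S.unop.unop.property
  obtain ⟨l, rfl⟩ := Quot.exists_rep l
  obtain ⟨χ, hχ⟩ := exists_point_of_prime (k := k) p
  obtain ⟨w, h, i, hh, hwh, hl⟩ := l.exists_generator χ
  obtain ⟨ψ, hψ⟩ := exists_form_ne_zero hh
  obtain ⟨O, j, hj⟩ := exists_basicOpen S (ψ h)
  have hftO : Algebra.FiniteType k (fn O) := O.unop.unop.property
  have hfib : ∀ χ' : fn O →ₐ[k] k, fibre C.coordRing χ' (bcVec C.coordRing (pb j) h) ≠ 0 :=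
    fibre_bcVec_ne_zero (pb j) hj.isUnit
  let σ := (bcRing C.coordRing (pb j)).toRingHom
  have hdvd : σ (w i) ∣ σ h := map_dvd σ hwh
  have hline : IsLinePoint C (fn O) (Submodule.span (fn O) {bcPi C N (pb j) w}) := by
    refine isLinePoint_span_singleton C fun χ' => ⟨i, fun h0 => hfib χ' ?_⟩
    exact zero_dvd_iff.1 (h0 ▸ map_dvd (fibre C.coordRing χ') hdvd)
  refine ⟨ψ h, hχ _ hψ, O, j, hj, ⟨_, hline⟩, ?_⟩
  -- The two lines are compared where the pull back of `h` does not vanish. This is a domain because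
  -- it contains the generic point of each fibre over the smaller base.
  refine GenericLine.mk_eq_mk _ (l.pullback (pb j)) (PrimeSpectrum.basicOpen (σ h)) ?_ ?_ ?_ ?_
  · exact isDomainOpen_iff.2 fun χ' hc => hfib χ' (mem_fibrePoint.1 hc)
  · intro q hq
    exact ⟨_, Submodule.mem_span_singleton_self _, i, fun hc =>
      hq (q.asIdeal.mem_of_dvd hdvd hc)⟩
  · intro q hq
    exact (hl (PrimeSpectrum.comap σ q) hq).1
  · intro q hq
    obtain ⟨_, hs⟩ := hl (PrimeSpectrum.comap σ q) hq
    refine (lineOf_span_singleton_stalk _ q _).trans (Eq.trans ?_ (congrArg (extend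
      (Localization.localRingHom (PrimeSpectrum.comap σ q).asIdeal q.asIdeal σ rfl)) hs).symm)
    rw [extend_span_singleton]
    congr 2
    refine funext fun i => ?_
    exact (Localization.localRingHom_to_map (PrimeSpectrum.comap σ q).asIdeal q.asIdeal σ rfl
      (w i)).symm

end Main

/-! ### Pull backs, colimits, quotients and sheafification. -/

section Presheaves

/-- The second leg of any cone takes values in the preimage because its composite with `p` factors
through `G`; uniqueness holds since inclusions are mono. -/
lemma isPullback_fromPreimage {D : Type*} [Category* D] {F F' : D ⥤ Type u} (G : Subfunctor F)
    (p : F' ⟶ F) : IsPullback (G.fromPreimage p) (G.preimage p).ι G.ι p := by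
  have hle : ∀ s : PullbackCone G.ι p, Subfunctor.range s.snd ≤ G.preimage p := by
    rintro s X _ ⟨x, rfl⟩
    have := ConcreteCategory.congr_hom (NatTrans.congr_app s.condition X) x
    change p.app X (s.snd.app X x) ∈ G.obj X
    exact this ▸ (s.fst.app X x).2
  refine ⟨⟨G.fromPreimage_ι p⟩, ⟨PullbackCone.IsLimit.mk _
    (fun s => Subfunctor.lift s.snd (hle s)) (fun s => ?_) (fun s => ?_) (fun s m _ hm => ?_)⟩⟩
  · rw [← cancel_mono G.ι, Category.assoc, G.fromPreimage_ι, ← Category.assoc,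
      Subfunctor.lift_ι, s.condition]
  · exact Subfunctor.lift_ι _ _
  · rw [← cancel_mono (G.preimage p).ι, hm, Subfunctor.lift_ι]

variable {k : Type u} [Field k]

instance : (zariski k).WEqualsLocallyBijective (Type u) :=
  GrothendieckTopology.WEqualsLocallyBijective.ofEssentiallySmall.{u} _

variable [IsAlgClosed k] {C : Curve k} {N : ℕ}

lemma lineIncl_injective (d : ℕ) (S : (Aff k)ᵒᵖ) :
    Function.Injective ((lineIncl C N d).app S) := by
  intro W W' h
  obtain ⟨ρ, hρ⟩ := evLine_retraction C (fn S) N d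
  have hinj : Function.Injective (evLine C (fn S) N d) :=
    Function.LeftInverse.injective (g := ρ) fun x => LinearMap.congr_fun hρ x
  exact Subtype.ext (Submodule.map_injective_of_injective hinj (congrArg Subtype.val h))

/-- The presheaf `𝓑_∞` is the colimit of the presheaves `𝓑_d`. -/
def isColimitSubCocone (𝓑 : Subfunctor (genericLines C N)) : IsColimit (subCocone 𝓑) := by
  refine evaluationJointlyReflectsColimits _ fun S => ?_
  refine Types.FilteredColimit.isColimitOf' _ _ ?_ ?_
  -- Over each `S` the set `𝓑_∞(S)` is the union of the images of the stages, by the definition of a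
  -- point of `𝓛_∞`.
  · rintro ⟨⟨_, d, W, hW, rfl⟩, hB⟩
    exact ⟨d, ⟨⟨W, hW⟩, hB⟩, rfl⟩
  · intro d x y h
    -- The maps to `𝓑_∞` are injective, so elements with the same image already agree at their own
    -- stage.
    refine ⟨d, 𝟙 d, congrArg _ (Subtype.ext (lineIncl_injective d S ?_))⟩
    exact congrArg Subtype.val h

/-- A local lift to `𝓛_∞` lies in `𝓑_∞` automatically, since its image is the restriction of a
section of `𝓑`. -/
lemma isLocallySurjective_subToGeneric (𝓑 : Subfunctor (genericLines C N)) :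
    Presheaf.IsLocallySurjective (zariski k) (subToGeneric 𝓑) where
  imageSieve_mem {S} l p := by
    obtain ⟨r, hr, O, j, hj, f, hf⟩ := exists_toGeneric_eq C (S := op S) l.1 p
    refine ⟨r, hr, O.unop, j.unop, hj, ⟨f, ?_⟩, Subtype.ext hf⟩
    change (toGeneric C N).app O f ∈ 𝓑.obj O
    rw [hf]
    exact 𝓑.map j l.2

lemma smul_mem_subLines (𝓑 : Subfunctor (genericLines C N)) {S : (Aff k)ᵒᵖ}
    (m : (scalars C).obj S) {f : (lines C N).obj S} (hf : f ∈ (subLines 𝓑).obj S) :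
    m • f ∈ (subLines 𝓑).obj S := by
  change (toGeneric C N).app S (m • f) ∈ 𝓑.obj S
  rw [toGeneric_smul]
  exact hf

lemma OrbitRel.subToGeneric_eq {𝓑 : Subfunctor (genericLines C N)} {S : (Aff k)ᵒᵖ}
    {f g : (subLines 𝓑).obj S} (h : OrbitRel (subLines 𝓑) S f g) :
    (subToGeneric 𝓑).app S f = (subToGeneric 𝓑).app S g := by
  obtain ⟨m, hm⟩ := h
  have : (toGeneric C N).app S f.1 = (toGeneric C N).app S g.1 := by
    rw [← hm, toGeneric_smul]
  exact Subtype.ext this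

lemma subToGeneric_subMap (𝓑 : Subfunctor (genericLines C N)) {S T : (Aff k)ᵒᵖ} (j : S ⟶ T)
    (x : (subLines 𝓑).obj S) : (subToGeneric 𝓑).app T (subMap (subLines 𝓑) j x) =
      𝓑.toFunctor.map j ((subToGeneric 𝓑).app S x) := by
  refine Subtype.ext ?_
  change (toGeneric C N).app T ((lines C N).map j x.1) =
    (genericLines C N).map j ((toGeneric C N).app S x.1)
  rw [NatTrans.naturality_apply]

/-- The map from the quotient of `𝓑_∞` by the action of `𝓜_∞` to `𝓑`. -/
def orbitsToGeneric (𝓑 : Subfunctor (genericLines C N)) :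
    orbits (subLines 𝓑) ⟶ 𝓑.toFunctor where
  app S := ↾(Quot.lift (r := OrbitRel (subLines 𝓑) S)
    (fun f : (subLines 𝓑).obj S => (subToGeneric 𝓑).app S f) fun _ _ h => h.subToGeneric_eq)
  naturality S T j := by
    refine ConcreteCategory.hom_ext _ _ fun x => ?_
    obtain ⟨x, rfl⟩ := Quot.exists_rep x
    change (subToGeneric 𝓑).app T (subMap (subLines 𝓑) j x) =
      𝓑.toFunctor.map j ((subToGeneric 𝓑).app S x)
    exact subToGeneric_subMap 𝓑 j x

lemma toOrbits_orbitsToGeneric (𝓑 : Subfunctor (genericLines C N)) :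
    toOrbits (subLines 𝓑) ≫ orbitsToGeneric 𝓑 = subToGeneric 𝓑 := rfl

/-- Over a small basic open set the two representatives have a common multiple `m₁ f = m₂ g`, so
their classes coincide already in the presheaf quotient. -/
lemma isLocallyInjective_orbitsToGeneric (𝓑 : Subfunctor (genericLines C N)) :
    Presheaf.IsLocallyInjective (zariski k) (orbitsToGeneric 𝓑) where
  equalizerSieve_mem {S} x y h p := by
    obtain ⟨f, rfl⟩ := Quot.exists_rep x
    obtain ⟨g, rfl⟩ := Quot.exists_rep y
    obtain ⟨r, hr, O, j, hj, m₁, m₂, hm⟩ :=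
      exists_smul_eq_smul_of_toGeneric_eq C (f := f.1) (g := g.1) (congrArg Subtype.val h) p
    refine ⟨r, hr, O.unop, j.unop, hj, ?_⟩
    let v : (subLines 𝓑).obj O :=
      ⟨m₁ • (lines C N).map j f.1, smul_mem_subLines 𝓑 m₁ ((subLines 𝓑).map j f.2)⟩
    have h₁ : OrbitRel (subLines 𝓑) O (subMap (subLines 𝓑) j f) v := ⟨m₁, rfl⟩
    have h₂ : OrbitRel (subLines 𝓑) O (subMap (subLines 𝓑) j g) v := ⟨m₂, hm.symm⟩
    exact (Quot.sound h₁).trans (Quot.sound h₂).symm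

lemma isLocallySurjective_orbitsToGeneric (𝓑 : Subfunctor (genericLines C N)) :
    Presheaf.IsLocallySurjective (zariski k) (orbitsToGeneric 𝓑) := by
  have := isLocallySurjective_subToGeneric 𝓑
  rw [← toOrbits_orbitsToGeneric] at this
  exact Presheaf.isLocallySurjective_of_isLocallySurjective (zariski k) (toOrbits (subLines 𝓑)) _

/-- Sheafification inverts precisely the locally bijective maps of presheaves. -/
lemma isIso_sheafification_orbitsToGeneric (𝓑 : Subfunctor (genericLines C N)) :
    IsIso ((presheafToSheaf (zariski k) (Type u)).map (orbitsToGeneric 𝓑)) :=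
  (GrothendieckTopology.W_iff _ _).1 ((GrothendieckTopology.W_iff_isLocallyBijective _ _).2
    ⟨isLocallyInjective_orbitsToGeneric 𝓑, isLocallySurjective_orbitsToGeneric 𝓑⟩)

end Presheaves

end GenericLines

end

theorem propositionp {k : Type u} [Field k] [IsAlgClosed k] [CharZero k] (C : Curve k) (N : ℕ)
    (𝓑 : Subfunctor (genericLines C N)) :
    (∀ d : ℕ, Mono (subStage 𝓑 d).ι ∧
      IsPullback (subStageToGeneric 𝓑 d) (subStage 𝓑 d).ι 𝓑.ι (stageToGeneric C N d)) ∧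
    IsPullback (subToGeneric 𝓑) (subLines 𝓑).ι 𝓑.ι (toGeneric C N) ∧
    Nonempty (IsColimit (subCocone 𝓑)) ∧
    Presheaf.IsLocallySurjective (zariski k) (subToGeneric 𝓑) ∧
    (∀ (S : (Aff k)ᵒᵖ) (m : (scalars C).obj S) (f : (lines C N).obj S),
      f ∈ (subLines 𝓑).obj S → m • f ∈ (subLines 𝓑).obj S) ∧
    (∀ (S : (Aff k)ᵒᵖ) (m : (scalars C).obj S) (f : (lines C N).obj S),
      f ∈ (subLines 𝓑).obj S → (toGeneric C N).app S (m • f) = (toGeneric C N).app S f) ∧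
    (∀ (S : (Aff k)ᵒᵖ) (m n : (scalars C).obj S) (f : (lines C N).obj S),
      f ∈ (subLines 𝓑).obj S → m • f = n • f → m = n) ∧
    (∀ (S : (Aff k)ᵒᵖ) (f g : (lines C N).obj S),
      f ∈ (subLines 𝓑).obj S → g ∈ (subLines 𝓑).obj S →
      (toGeneric C N).app S f = (toGeneric C N).app S g →
      ∀ p : PrimeSpectrum (fn S), ∃ r : fn S, r ∉ p.asIdeal ∧
        ∃ (O : (Aff k)ᵒᵖ) (j : S ⟶ O), IsBasicOpen (pb j).toRingHom r ∧
          ∃ m₁ m₂ : (scalars C).obj O,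
            m₁ • (lines C N).map j f = m₂ • (lines C N).map j g) ∧
    ∃ q : orbits (subLines 𝓑) ⟶ 𝓑.toFunctor, toOrbits (subLines 𝓑) ≫ q = subToGeneric 𝓑 ∧
      IsIso ((presheafToSheaf (zariski k) (Type u)).map q) :=
  ⟨fun _ => ⟨inferInstance, isPullback_fromPreimage 𝓑 _⟩, isPullback_fromPreimage 𝓑 _,
    ⟨isColimitSubCocone 𝓑⟩, isLocallySurjective_subToGeneric 𝓑,
    fun _ m _ hf => smul_mem_subLines 𝓑 m hf, fun _ m f _ => toGeneric_smul C m f,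
    fun _ _ _ _ _ h => smul_injective C h,
    fun _ _ _ _ _ h p => exists_smul_eq_smul_of_toGeneric_eq C h p,
    orbitsToGeneric 𝓑, toOrbits_orbitsToGeneric 𝓑, isIso_sheafification_orbitsToGeneric 𝓑⟩
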